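/- Let $\mathbb{V}$ be a complex vector space of dimension $n+1$ ($n\ge 0$), let $\mathbb{P}=\mathbb{P}(\mathbb{V})$ and $\mathbb{P}^*=\mathbb{P}(\mathbb{V}^*)$ be the projective spaces of $\mathbb{V}$ and of its dual, and let $\mathbb{S}=\{([x],[\xi])\in\mathbb{P}\times\mathbb{P}^* : \langle\xi,x\rangle=0\}$ be the incidence hypersurface. For a complex manifold $X$ let $\dot T^*X$ be its holomorphic cotangent bundle with the zero section removed, with its $\mathbb{C}^\times$-action, its Liouville form $\alpha_X$ and its symplectic form $d\alpha_X$, and let $P^*X=\dot T^*X/\mathbb{C}^\times$, with the canonical contact structure $\ker\alpha_X$. Equip $\mathbb{S}$ with the contact structure given by the sum of the tangent spaces to the fibres of the two projections $\mathbb{S}\to\mathbb{P}$ and $\mathbb{S}\to\mathbb{P}^*$, i.e. the kernel of $\langle\xi,dx\rangle|_{\mathbb{S}}$. Let $\rho:\mathbb{V}\setminus\{0\}\to\mathbb{P}$ and $\rho_*:\mathbb{V}^*\setminus\{0\}\to\mathbb{P}^*$ be the projections. (i) There is a homogeneous symplectic isomorphism $\chi:\dot T^*\mathbb{P}\to\dot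 T^*\mathbb{P}^*$, i.e. a biholomorphic map commuting with the actions of $\mathbb{C}^\times$ such that $\chi^*\alpha_{\mathbb{P}^*}=\alpha_{\mathbb{P}}$ and $\chi^*d\alpha_{\mathbb{P}^*}=d\alpha_{\mathbb{P}}$, which is induced by $(x,\xi)\mapsto(\xi,-x)$: if $x\in\mathbb{V}\setminus\{0\}$ and $\xi\in\mathbb{V}^*\setminus\{0\}$, and $p$ is a nonzero covector of $\mathbb{P}$ at $[x]$ whose pull-back by $\rho$ to the point $x$ is $\xi$, then $\chi([x],p)=([\xi],q)$, where $q$ is the nonzero covector of $\mathbb{P}^*$ at $[\xi]$ whose pull-back by $\rho_*$ to the point $\xi$ is $-x$ (as an element of $\mathbb{V}^{**}$). (ii) There are contact isomorphisms, i.e. biholomorphic maps whose differentials carry the contact hyperplanes onto the contact hyperplanes, $$P^*\mathbb{P}\;\simeq\;\mathbb{S}\;\simeq\;P^*\mathbb{P}^*.$$ They are given as follows: if $p$ is a nonzero covector at $[x]$ whose pull-back to the point $x$ is $\xi$, then $([x],[p])$ corresponds to $([x],[\xi])\in\mathbb{S}$; if $q$ is a nonzero covector at $[\xi]$ whose pull-back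 to the point $\xi$ is $x$, then $([\xi],[q])$ corresponds to $([x],[\xi])\in\mathbb{S}$. -/

import Mathlib

open scoped Manifold ContDiff LinearAlgebra.Projectivization Topology
open Bundle Set Module
noncomputable section

/-! ### Complex projective spaces -/

section ProjectiveSpace

variable {V : Type*} [AddCommGroup V] [Module ℂ V]

/-- The quotient topology on a complex projective space. -/
instance projTopology [TopologicalSpace V] : TopologicalSpace (ℙ ℂ V) :=
  inferInstanceAs (TopologicalSpace (Quotient (projectivizationSetoid ℂ V)))

theorem isOpenQuotientMap_projMk [TopologicalSpace V] [ContinuousConstSMul ℂ V] :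
    IsOpenQuotientMap (Projectivization.mk' ℂ : {v : V // v ≠ 0} → ℙ ℂ V) := by
  refine ⟨Quotient.mk_surjective, continuous_quot_mk, fun U hU => ?_⟩
  refine isOpen_coinduced.mpr ?_
  have h : (Projectivization.mk' ℂ : {v : V // v ≠ 0} → ℙ ℂ V) ⁻¹'
      ((Projectivization.mk' ℂ : {v : V // v ≠ 0} → ℙ ℂ V) '' U) =
      ⋃ a : ℂˣ, (fun v : {v : V // v ≠ 0} =>
        (⟨a • v.1, (smul_ne_zero_iff_ne a).mpr v.2⟩ : {v : V // v ≠ 0})) ⁻¹' U := by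
    ext v
    simp only [mem_preimage, mem_image, mem_iUnion]
    constructor
    · rintro ⟨w, hw, hwv⟩
      obtain ⟨a, ha⟩ := (Projectivization.mk_eq_mk_iff ℂ _ _ w.2 v.2).mp hwv
      exact ⟨a, by simpa only [ha] using hw⟩
    · rintro ⟨a, ha⟩
      exact ⟨_, ha, (Projectivization.mk_eq_mk_iff ℂ _ _ _ v.2).mpr ⟨a, rfl⟩⟩
  erw [h]
  refine isOpen_iUnion fun a => hU.preimage ?_
  exact (continuous_subtype_val.const_smul a).subtype_mk _

variable [TopologicalSpace V]

/-- The affine chart of `ℙ V` attached to linear coordinates `e : V ≃ ℂ × F`: it is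
`[v] ↦ v' / v₀`, where `e v = (v₀, v')`, on the open set `v₀ ≠ 0`. -/
def affineChart [ContinuousConstSMul ℂ V] {F : Type*} [NormedAddCommGroup F] [NormedSpace ℂ F]
    (e : V ≃L[ℂ] ℂ × F) : OpenPartialHomeomorph (ℙ ℂ V) F where
  toFun := Projectivization.lift (fun v => (e v.1).1⁻¹ • (e v.1).2) (by
    rintro ⟨a, ha⟩ ⟨b, hb⟩ t (rfl : a = t • b)
    have ht : t ≠ 0 := by rintro rfl; simp at ha
    simp only [map_smul, Prod.smul_fst, Prod.smul_snd, smul_eq_mul, mul_inv, smul_smul]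
    congr 1
    field_simp)
  invFun y := Projectivization.mk ℂ (e.symm (1, y)) (by simp)
  source := {p | Projectivization.lift (fun v => (e v.1).1 ≠ 0) (by
    rintro ⟨a, ha⟩ ⟨b, hb⟩ t (rfl : a = t • b)
    have ht : t ≠ 0 := by rintro rfl; simp at ha
    simp [ht]) p}
  target := univ
  map_source' _ _ := mem_univ _
  map_target' y _ := by simp
  left_inv' p hp := by
    induction p with
    | h v hv =>
      have h0 : (e v).1 ≠ 0 := hp
      refine (Projectivization.mk_eq_mk_iff' ℂ _ _ _ _).mpr ⟨(e v).1⁻¹, ?_⟩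
      apply e.injective
      ext <;> simp [h0]
  right_inv' y _ := by simp
  open_source := by
    refine isOpenQuotientMap_projMk.isQuotientMap.isOpen_preimage.mp ?_
    exact isOpen_ne.preimage
      (continuous_fst.comp (e.continuous.comp continuous_subtype_val))
  open_target := isOpen_univ
  continuousOn_toFun := by
    refine (isOpenQuotientMap_projMk.isQuotientMap.continuousOn_isOpen_iff ?_).mpr ?_
    · refine isOpenQuotientMap_projMk.isQuotientMap.isOpen_preimage.mp ?_
      exact isOpen_ne.preimage
        (continuous_fst.comp (e.continuous.comp continuous_subtype_val))
    · have h : Continuous fun v : {v : V // v ≠ 0} => e v.1 :=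
        e.continuous.comp continuous_subtype_val
      exact ContinuousOn.smul (ContinuousOn.inv₀ h.fst.continuousOn fun v hv => hv)
        h.snd.continuousOn
  continuousOn_invFun := by
    refine Continuous.continuousOn ?_
    exact isOpenQuotientMap_projMk.continuous.comp
      ((e.symm.continuous.comp (by fun_prop : Continuous fun y : F => ((1 : ℂ), y))).subtype_mk _)

theorem mk_mem_affineChart_source [ContinuousConstSMul ℂ V] {F : Type*} [NormedAddCommGroup F]
    [NormedSpace ℂ F] (e : V ≃L[ℂ] ℂ × F) {v : V} (hv : v ≠ 0) :
    Projectivization.mk ℂ v hv ∈ (affineChart e).source ↔ (e v).1 ≠ 0 := Iff.rfl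

@[simp] theorem affineChart_mk [ContinuousConstSMul ℂ V] {F : Type*} [NormedAddCommGroup F]
    [NormedSpace ℂ F] (e : V ≃L[ℂ] ℂ × F) {v : V} (hv : v ≠ 0) :
    affineChart e (Projectivization.mk ℂ v hv) = (e v).1⁻¹ • (e v).2 := rfl

theorem affineChart_symm_apply [ContinuousConstSMul ℂ V] {F : Type*} [NormedAddCommGroup F]
    [NormedSpace ℂ F] (e : V ≃L[ℂ] ℂ × F) (y : F) :
    (affineChart e).symm y = Projectivization.mk ℂ (e.symm (1, y)) (by simp) := rfl

end ProjectiveSpace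

section ProjectiveManifold

variable (V : Type*) [NormedAddCommGroup V] [NormedSpace ℂ V]

/-- The model space of the projective space of `V`, of dimension `dim V - 1`. -/
abbrev ProjModel : Type := Fin (finrank ℂ V - 1) → ℂ

variable {V} [FiniteDimensional ℂ V]

theorem exists_affine_coordinates {x : V} (hx : x ≠ 0) :
    ∃ e : V ≃L[ℂ] ℂ × ProjModel V, (e x).1 ≠ 0 := by
  obtain ⟨f, hf⟩ := SeparatingDual.exists_eq_one (R := ℂ) hx
  have hsurj : Function.Surjective (f : V →ₗ[ℂ] ℂ) := fun c => ⟨c • x, by simp [hf]⟩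
  have hdim : finrank ℂ (LinearMap.ker (f : V →ₗ[ℂ] ℂ)) = finrank ℂ (ProjModel V) := by
    have h1 := LinearMap.finrank_range_add_finrank_ker (f : V →ₗ[ℂ] ℂ)
    rw [LinearMap.range_eq_top.mpr hsurj] at h1
    simp at h1 ⊢
    omega
  let g := LinearEquiv.ofFinrankEq _ _ hdim
  let q : V →ₗ[ℂ] LinearMap.ker (f : V →ₗ[ℂ] ℂ) :=
    (LinearMap.id - (f : V →ₗ[ℂ] ℂ).smulRight x).codRestrict _ (fun v => by simp [hf])
  have hq : ∀ v, (q v : V) = v - f v • x := fun v => rfl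
  let e₁ : V ≃ₗ[ℂ] ℂ × ProjModel V :=
    { (f : V →ₗ[ℂ] ℂ).prod (g.toLinearMap ∘ₗ q) with
      invFun p := p.1 • x + g.symm p.2
      left_inv v := by simp [hq]
      right_inv p := by
        have h : f (g.symm p.2 : V) = 0 := (g.symm p.2).2
        have h2 : q (p.1 • x + g.symm p.2) = g.symm p.2 := by
          ext; simp [hq, hf, h]
        ext1
        · simp [hf, h]
        · change g (q (p.1 • x + g.symm p.2)) = p.2
          rw [h2, g.apply_symm_apply] }
  exact ⟨e₁.toContinuousLinearEquiv, by simp [e₁, hf]⟩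

/-- The complex manifold structure of `ℙ V`: all affine charts. -/
instance projChartedSpace : ChartedSpace (ProjModel V) (ℙ ℂ V) where
  atlas := range affineChart
  chartAt p := affineChart (exists_affine_coordinates p.rep_nonzero).choose
  mem_chart_source p := by
    have h := (mk_mem_affineChart_source _ p.rep_nonzero).mpr
      (exists_affine_coordinates p.rep_nonzero).choose_spec
    rwa [p.mk_rep] at h
  chart_mem_atlas _ := mem_range_self _

instance projIsManifold : IsManifold 𝓘(ℂ, ProjModel V) ω (ℙ ℂ V) := by
  refine isManifold_of_contDiffOn _ _ _ ?_
  rintro _ _ ⟨e, rfl⟩ ⟨e', rfl⟩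
  have h : ContDiffOn ℂ ω (fun y : ProjModel V =>
      (e' (e.symm (1, y))).1⁻¹ • (e' (e.symm (1, y))).2) {y | (e' (e.symm (1, y))).1 ≠ 0} := by
    refine ContDiffOn.smul (ContDiffOn.inv ?_ fun y hy => hy) ?_
    · exact ContDiff.contDiffOn (by fun_prop)
    · exact ContDiff.contDiffOn (by fun_prop)
  refine (h.mono ?_).congr ?_
  · rintro y ⟨⟨-, hy⟩, -⟩
    exact hy
  · intro y hy
    rfl

end ProjectiveManifold


/-! ### Projectivization of a vector bundle -/

/-- The bijection of projective spaces induced by a linear isomorphism. -/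
def projEquiv {A B : Type*} [AddCommGroup A] [Module ℂ A] [TopologicalSpace A] [AddCommGroup B]
    [Module ℂ B] [TopologicalSpace B] (L : A ≃L[ℂ] B) : ℙ ℂ A ≃ ℙ ℂ B where
  toFun := Projectivization.map L.toLinearEquiv.toLinearMap L.injective
  invFun := Projectivization.map L.symm.toLinearEquiv.toLinearMap L.symm.injective
  left_inv p := by
    induction p with
    | h v hv => simp [Projectivization.map_mk]
  right_inv p := by
    induction p with
    | h v hv => simp [Projectivization.map_mk]

@[simp] theorem projEquiv_mk {A B : Type*} [AddCommGroup A] [Module ℂ A] [TopologicalSpace A]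
    [AddCommGroup B] [Module ℂ B] [TopologicalSpace B] (L : A ≃L[ℂ] B) (v : A) (hv : v ≠ 0) :
    projEquiv L (Projectivization.mk ℂ v hv) =
      Projectivization.mk ℂ (L v) (by simpa using hv) := rfl

theorem continuous_projEquiv {A B : Type*} [AddCommGroup A] [Module ℂ A] [TopologicalSpace A]
    [AddCommGroup B] [Module ℂ B] [TopologicalSpace B] (L : A ≃L[ℂ] B) :
    Continuous (projEquiv L) := by
  refine continuous_coinduced_dom.mpr ?_
  refine Continuous.comp (g := Projectivization.mk' ℂ)
    (f := fun v : {v : A // v ≠ 0} => (⟨L v.1, by simpa using v.2⟩ : {v : B // v ≠ 0}))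
    continuous_quot_mk ?_
  exact (L.continuous.comp continuous_subtype_val).subtype_mk _

section ProjectiveBundle

variable {B F : Type*} [TopologicalSpace B] [NormedAddCommGroup F] [NormedSpace ℂ F]
  {W : B → Type*} [TopologicalSpace (TotalSpace F W)] [∀ b, AddCommGroup (W b)]
  [∀ b, Module ℂ (W b)] [∀ b, TopologicalSpace (W b)] [FiberBundle F W] [VectorBundle ℂ F W]

open Classical in
/-- The linear isomorphism `W b ≃ F` given by a trivialization `t` of `W`
(for `b` in its base set; otherwise the one given by the preferred trivialization at `b`). -/
def trivFiberEquiv (t : Trivialization F (π F W)) [MemTrivializationAtlas t] (b : B) :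
    W b ≃L[ℂ] F :=
  if h : b ∈ t.baseSet then t.continuousLinearEquivAt ℂ b h
  else (trivializationAt F W b).continuousLinearEquivAt ℂ b
    (FiberBundle.mem_baseSet_trivializationAt' b)

theorem trivFiberEquiv_trans (t t' : Trivialization F (π F W)) [MemTrivializationAtlas t]
    [MemTrivializationAtlas t'] {b : B} (hb : b ∈ t.baseSet ∩ t'.baseSet) (v : F) :
    trivFiberEquiv t' b ((trivFiberEquiv t b).symm v) = t.coordChangeL ℂ t' b v := by
  rw [trivFiberEquiv, trivFiberEquiv, dif_pos hb.1, dif_pos hb.2,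
    ← Trivialization.comp_continuousLinearEquivAt_eq_coord_change t t' hb]
  rfl

/-- The local trivialization `(b, [w]) ↦ (b, [t w])` of the projectivization of a vector bundle
`W` induced by a local trivialization `t` of `W`. -/
def projPretrivialization (t : Trivialization F (π F W)) [MemTrivializationAtlas t] :
    Pretrivialization (ℙ ℂ F) (π (ℙ ℂ F) fun b => ℙ ℂ (W b)) where
  toFun z := (z.1, projEquiv (trivFiberEquiv t z.1) z.2)
  invFun p := ⟨p.1, (projEquiv (trivFiberEquiv t p.1)).symm p.2⟩
  source := π (ℙ ℂ F) (fun b => ℙ ℂ (W b)) ⁻¹' t.baseSet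
  target := t.baseSet ×ˢ univ
  map_source' _ hz := ⟨hz, mem_univ _⟩
  map_target' _ hp := hp.1
  left_inv' z _ := by simp
  right_inv' p _ := by simp
  open_target := t.open_baseSet.prod isOpen_univ
  baseSet := t.baseSet
  open_baseSet := t.open_baseSet
  source_eq := rfl
  target_eq := rfl
  proj_toFun _ _ := rfl

theorem projPretrivialization_change (t t' : Trivialization F (π F W)) [MemTrivializationAtlas t]
    [MemTrivializationAtlas t'] {b : B} (hb : b ∈ t.baseSet ∩ t'.baseSet) (p : ℙ ℂ F) :
    projPretrivialization t' ((projPretrivialization t).toPartialEquiv.symm (b, p)) =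
      (b, projEquiv (t.coordChangeL ℂ t' b) p) := by
  change (b, projEquiv (trivFiberEquiv t' b) ((projEquiv (trivFiberEquiv t b)).symm p)) = _
  induction p with
  | h v hv =>
    congr 1
    simp only [projEquiv_mk, ← trivFiberEquiv_trans t t' hb]
    rfl

/-- The projectivization of a vector bundle `W`, with fibers `ℙ (W b)`, as a fiber bundle. -/
def projPrebundle (F : Type*) [NormedAddCommGroup F] [NormedSpace ℂ F]
  (W : B → Type*) [TopologicalSpace (TotalSpace F W)] [∀ b, AddCommGroup (W b)]
  [∀ b, Module ℂ (W b)] [∀ b, TopologicalSpace (W b)] [FiberBundle F W] [VectorBundle ℂ F W] :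
    FiberPrebundle (ℙ ℂ F) (fun b => ℙ ℂ (W b)) where
  pretrivializationAtlas := {s | ∃ (t : Trivialization F (π F W)) (_ : MemTrivializationAtlas t),
    s = projPretrivialization t}
  pretrivializationAt b := projPretrivialization (trivializationAt F W b)
  mem_base_pretrivializationAt b := FiberBundle.mem_baseSet_trivializationAt' b
  pretrivialization_mem_atlas b := ⟨_, inferInstance, rfl⟩
  continuous_trivChange := by
    rintro _ ⟨t', _, rfl⟩ _ ⟨t, _, rfl⟩
    have hset : (projPretrivialization t).target ∩
        (projPretrivialization t).toPartialEquiv.symm ⁻¹' (projPretrivialization t').source =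
        (t.baseSet ∩ t'.baseSet) ×ˢ (univ : Set (ℙ ℂ F)) := by
      ext p
      exact ⟨fun h => ⟨⟨h.1.1, h.2⟩, mem_univ _⟩, fun h => ⟨⟨h.1.1, mem_univ _⟩, h.1.2⟩⟩
    rw [hset]
    have hcongr : EqOn (projPretrivialization t' ∘ (projPretrivialization t).toPartialEquiv.symm)
        (fun p => (p.1, projEquiv (t.coordChangeL ℂ t' p.1) p.2))
        ((t.baseSet ∩ t'.baseSet) ×ˢ (univ : Set (ℙ ℂ F))) :=
      fun p hp => projPretrivialization_change t t' hp.1 p.2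
    refine ContinuousOn.congr ?_ hcongr
    refine continuousOn_fst.prodMk ?_
    have hq := (IsOpenQuotientMap.id (X := B)).prodMap (isOpenQuotientMap_projMk (V := F))
    refine (hq.isQuotientMap.continuousOn_isOpen_iff
      ((t.open_baseSet.inter t'.open_baseSet).prod isOpen_univ)).mpr ?_
    rw [continuousOn_iff_continuous_domRestrict]
    refine Continuous.comp (g := Projectivization.mk' ℂ)
      (f := fun p : ↥((Prod.map (id : B → B) (Projectivization.mk' ℂ : {v : F // v ≠ 0} → _)) ⁻¹'
        ((t.baseSet ∩ t'.baseSet) ×ˢ (univ : Set (ℙ ℂ F)))) =>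
        (⟨t.coordChangeL ℂ t' p.1.1 p.1.2.1, by simpa using p.1.2.2⟩ : {v : F // v ≠ 0}))
      continuous_quot_mk ?_
    refine Continuous.subtype_mk ?_ _
    have hc := (continuousOn_coordChange (R := ℂ) t t')
    rw [continuousOn_iff_continuous_domRestrict] at hc
    have h1 : Continuous fun p : ↥((Prod.map (id : B → B)
        (Projectivization.mk' ℂ : {v : F // v ≠ 0} → _)) ⁻¹'
        ((t.baseSet ∩ t'.baseSet) ×ˢ (univ : Set (ℙ ℂ F)))) =>
        (t.coordChangeL ℂ t' p.1.1 : F →L[ℂ] F) :=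
      hc.comp ((continuous_fst.comp continuous_subtype_val).subtype_mk fun p => p.2.1)
    exact h1.clm_apply (by fun_prop)
  totalSpaceMk_isInducing b := by
    let L : W b ≃L[ℂ] F := trivFiberEquiv (trivializationAt F W b) b
    let h : ℙ ℂ (W b) ≃ₜ ℙ ℂ F :=
      { projEquiv L with
        continuous_toFun := continuous_projEquiv L
        continuous_invFun := continuous_projEquiv L.symm }
    exact Topology.isInducing_const_prod.mpr h.isInducing

instance projBundleTopology : TopologicalSpace (TotalSpace (ℙ ℂ F) fun b => ℙ ℂ (W b)) :=
  (projPrebundle F W).totalSpaceTopology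

instance projFiberBundle : FiberBundle (ℙ ℂ F) (fun b => ℙ ℂ (W b)) :=
  (projPrebundle F W).toFiberBundle

variable {HB : Type*} [TopologicalSpace HB] [ChartedSpace HB B] [FiniteDimensional ℂ F]

/-- The charts of the projectivization of a vector bundle: a local trivialization, followed by
a chart of the base and an affine chart of the projective space of the model fiber. -/
instance projBundleChartedSpace :
    ChartedSpace (ModelProd HB (ProjModel F)) (TotalSpace (ℙ ℂ F) fun b => ℙ ℂ (W b)) :=
  ChartedSpace.comp (ModelProd HB (ProjModel F)) (B × ℙ ℂ F) _

instance projBundleIsManifold {EB : Type*} [NormedAddCommGroup EB] [NormedSpace ℂ EB]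
    [ChartedSpace EB B] [IsManifold 𝓘(ℂ, EB) ω B] [ContMDiffVectorBundle ω F W 𝓘(ℂ, EB)] :
    IsManifold (𝓘(ℂ, EB).prod 𝓘(ℂ, ProjModel F)) ω (TotalSpace (ℙ ℂ F) fun b => ℙ ℂ (W b)) := by
  refine isManifold_of_contDiffOn _ _ _ ?_
  rintro _ _ ⟨_, ⟨_, ⟨_, ⟨t, ht, rfl⟩, rfl⟩, rfl⟩, _, ⟨φ, hφ, _, ⟨a, rfl⟩, rfl⟩, rfl⟩
    ⟨_, ⟨_, ⟨_, ⟨t', ht', rfl⟩, rfl⟩, rfl⟩, _, ⟨φ', hφ', _, ⟨a', rfl⟩, rfl⟩, rfl⟩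
  have hφs : ContMDiffOn 𝓘(ℂ, EB) 𝓘(ℂ, EB) ω φ.symm φ.target :=
    contMDiffOn_symm_of_mem_maximalAtlas (IsManifold.subset_maximalAtlas hφ)
  have hφ's : ContMDiffOn 𝓘(ℂ, EB) 𝓘(ℂ, EB) ω φ' φ'.source :=
    contMDiffOn_of_mem_maximalAtlas (IsManifold.subset_maximalAtlas hφ')
  let D : Set EB := φ.target ∩ φ.symm ⁻¹' (φ'.source ∩ (t.baseSet ∩ t'.baseSet))
  have h1 : ContDiffOn ℂ ω (φ' ∘ φ.symm) D :=
    (hφ's.comp (hφs.mono fun u hu => hu.1) (fun u hu => hu.2.1)).contDiffOn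
  have h2 : ContDiffOn ℂ ω (fun u => (t.coordChangeL ℂ t' (φ.symm u) : F →L[ℂ] F)) D :=
    ((contMDiffOn_coordChangeL (IB := 𝓘(ℂ, EB)) (n := ω) t t').comp
      (hφs.mono fun u hu => hu.1) (fun u hu => hu.2.2)).contDiffOn
  let g : EB × ProjModel F → ℂ × ProjModel F :=
    fun p => a' (t.coordChangeL ℂ t' (φ.symm p.1) (a.symm (1, p.2)))
  have h3 : ContDiffOn ℂ ω g (D ×ˢ univ) := by
    refine a'.contDiff.comp_contDiffOn ?_
    refine ContDiffOn.clm_apply (h2.comp contDiffOn_fst fun p hp => hp.1) ?_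
    exact ContDiff.contDiffOn (by fun_prop)
  have h4 : ContDiffOn ℂ ω (fun p : EB × ProjModel F => ((φ' ∘ φ.symm) p.1, (g p).1⁻¹ • (g p).2))
      ((D ×ˢ univ) ∩ {p | (g p).1 ≠ 0}) := by
    refine ContDiffOn.prodMk ((h1.comp contDiffOn_fst fun p hp => hp.1).mono inter_subset_left) ?_
    have h5 := h3.mono (inter_subset_left (t := {p | (g p).1 ≠ 0}))
    exact (h5.fst.inv fun p hp => hp.2).smul h5.snd
  have key : ∀ p : EB × ProjModel F, p.1 ∈ D →
      projPretrivialization t' ((projPretrivialization t).toPartialEquiv.symm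
        (φ.symm p.1, (affineChart a).symm p.2)) =
      (φ.symm p.1, Projectivization.mk ℂ (t.coordChangeL ℂ t' (φ.symm p.1) (a.symm (1, p.2)))
        (by simp)) := fun p hp => projPretrivialization_change t t' hp.2.2 _
  have hdom : ∀ p : EB × ProjModel F, p.1 ∈ φ.target → φ.symm p.1 ∈ t.baseSet →
      φ.symm p.1 ∈ t'.baseSet →
      projPretrivialization t' ((projPretrivialization t).toPartialEquiv.symm
        (φ.symm p.1, (affineChart a).symm p.2)) ∈ φ'.source ×ˢ (affineChart a').source →
      p.1 ∈ D ∧ (g p).1 ≠ 0 := by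
    intro p h1 h2 h3 h4
    have h5 : p.1 ∈ D := ⟨h1, h4.1, h2, h3⟩
    rw [key p h5] at h4
    exact ⟨h5, h4.2⟩
  refine (h4.mono ?_).congr ?_
  · rintro p ⟨⟨⟨⟨hp1, -⟩, hp2⟩, hp3⟩, -⟩
    have h := hdom p hp1 hp2.1 hp3.1 hp3.2
    exact ⟨⟨h.1, mem_univ _⟩, h.2⟩
  · rintro p ⟨⟨⟨⟨hp1, -⟩, hp2⟩, hp3⟩, -⟩
    have h := hdom p hp1 hp2.1 hp3.1 hp3.2
    change (φ'.prod (affineChart a')) (projPretrivialization t'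
      ((projPretrivialization t).toPartialEquiv.symm
        (φ.symm p.1, (affineChart a).symm p.2))) = _
    rw [key p h.1]
    rfl

end ProjectiveBundle

/-! ### The incidence hypersurface -/

section Incidence

variable (V : Type*) [NormedAddCommGroup V] [NormedSpace ℂ V]

/-- The incidence hypersurface `{([x], [ξ]) | ⟨ξ, x⟩ = 0}` in `ℙ × ℙ*`, where `ℙ* = ℙ(V*)`. -/
def incidence : Set (ℙ ℂ V × ℙ ℂ (V →L[ℂ] ℂ)) := {s | s.2.rep s.1.rep = 0}

variable {V}

theorem mem_incidence_mk {x : V} (hx : x ≠ 0) {ξ : V →L[ℂ] ℂ} (hξ : ξ ≠ 0) :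
    (Projectivization.mk ℂ x hx, Projectivization.mk ℂ ξ hξ) ∈ incidence V ↔ ξ x = 0 := by
  obtain ⟨a, ha⟩ := Projectivization.exists_smul_eq_mk_rep ℂ x hx
  obtain ⟨b, hb⟩ := Projectivization.exists_smul_eq_mk_rep ℂ ξ hξ
  change (Projectivization.mk ℂ ξ hξ).rep (Projectivization.mk ℂ x hx).rep = 0 ↔ _
  rw [← ha, ← hb]
  simp [Units.smul_def]

variable (V) in
/-- Auxiliary coordinate space of dimension `dim V - 2`. -/
abbrev MidCoord : Type := Fin (finrank ℂ V - 2) → ℂ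

variable (V) in
/-- The model space of the incidence hypersurface, of dimension `2 (dim V - 1) - 1`
(if `dim V ≥ 2`; the hypersurface is empty otherwise). -/
abbrev IncidenceModel : Type := (MidCoord V × ℂ) × (MidCoord V →L[ℂ] ℂ)

variable [FiniteDimensional ℂ V]

/-- The linear coordinates on `V*` dual to linear coordinates `v ↦ (v₀, v', v₁)` on `V`, listed as
`ξ ↦ (ξ₁, ξ', ξ₀)`, so that `ξ v = ξ₀ v₀ + ξ' v' + ξ₁ v₁`. -/
def dualCoord (e : V ≃L[ℂ] ℂ × MidCoord V × ℂ) :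
    (V →L[ℂ] ℂ) ≃L[ℂ] ℂ × (MidCoord V →L[ℂ] ℂ) × ℂ :=
  LinearEquiv.toContinuousLinearEquiv
    { toFun ξ := (ξ (e.symm (0, 0, 1)),
        ξ ∘L (e.symm : ℂ × MidCoord V × ℂ →L[ℂ] V) ∘L
          ContinuousLinearMap.inr ℂ ℂ (MidCoord V × ℂ) ∘L
          ContinuousLinearMap.inl ℂ (MidCoord V) ℂ,
        ξ (e.symm (1, 0, 0)))
      map_add' ξ ζ := by ext <;> simp
      map_smul' c ξ := by ext <;> simp
      invFun p := (p.2.2 • ContinuousLinearMap.fst ℂ ℂ (MidCoord V × ℂ) +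
        (p.2.1 ∘L ContinuousLinearMap.fst ℂ (MidCoord V) ℂ +
          p.1 • ContinuousLinearMap.snd ℂ (MidCoord V) ℂ) ∘L
          ContinuousLinearMap.snd ℂ ℂ (MidCoord V × ℂ)) ∘L
        (e : V →L[ℂ] ℂ × MidCoord V × ℂ)
      left_inv ξ := by
        ext v
        obtain ⟨⟨a, y, t⟩, rfl⟩ := e.symm.surjective v
        have h : ((a, y, t) : ℂ × MidCoord V × ℂ) =
            a • (1, 0, 0) + (0, y, 0) + t • (0, 0, 1) := by
          ext <;> simp
        have h' := congrArg (fun p => ξ (e.symm p)) h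
        simp only [map_add, map_smul, smul_eq_mul] at h'
        simp [h']
        ring
      right_inv p := by
        ext <;> simp }

theorem dualCoord_pairing (e : V ≃L[ℂ] ℂ × MidCoord V × ℂ) (ξ : V →L[ℂ] ℂ) (v : V) :
    ξ v = (dualCoord e ξ).2.2 * (e v).1 + (dualCoord e ξ).2.1 (e v).2.1 +
      (dualCoord e ξ).1 * (e v).2.2 := by
  have h := congrArg (fun ζ : V →L[ℂ] ℂ => ζ v) ((dualCoord e).symm_apply_apply ξ)
  rw [← h]
  generalize dualCoord e ξ = p
  change p.2.2 * (e v).1 + (p.2.1 (e v).2.1 + p.1 * (e v).2.2) = _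
  ring

/-- A chart of the incidence hypersurface. In linear coordinates `v ↦ (v₀, v', v₁)` on `V` and the
dual coordinates on `V*`, the incidence relation is `ξ₀ x₀ + ξ' x' + ξ₁ x₁ = 0`. On the open set
`x₀ ≠ 0`, `ξ₁ ≠ 0` normalized by `x₀ = 1`, `ξ₁ = 1` this is the graph `ξ₀ = -(ξ' x' + x₁)`, and
`(x', x₁, ξ')` are coordinates. -/
def incidenceChart (e : V ≃L[ℂ] ℂ × MidCoord V × ℂ) :
    OpenPartialHomeomorph (incidence V) (IncidenceModel V) where
  toFun s := (affineChart e s.1.1, (affineChart (dualCoord e) s.1.2).1)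
  invFun y := ⟨((affineChart e).symm y.1,
      (affineChart (dualCoord e)).symm (y.2, -(y.2 y.1.1 + y.1.2))), by
    rw [affineChart_symm_apply, affineChart_symm_apply, mem_incidence_mk, dualCoord_pairing e]
    simp⟩
  source := {s | s.1.1 ∈ (affineChart e).source ∧ s.1.2 ∈ (affineChart (dualCoord e)).source}
  target := univ
  map_source' _ _ := mem_univ _
  map_target' y _ := ⟨(affineChart e).map_target (mem_univ _),
    (affineChart (dualCoord e)).map_target (mem_univ _)⟩
  left_inv' := by
    rintro ⟨⟨p, q⟩, hs⟩ ⟨h1, h2⟩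
    ext1
    refine Prod.ext ((affineChart e).left_inv h1) ?_
    refine Eq.trans ?_ ((affineChart (dualCoord e)).left_inv h2)
    refine congrArg (affineChart (dualCoord e)).symm (Prod.ext rfl ?_)
    induction p with
    | h x hx =>
      induction q with
      | h ξ hξ =>
        rw [mem_incidence_mk, dualCoord_pairing e] at hs
        replace h1 : (e x).1 ≠ 0 := h1
        replace h2 : (dualCoord e ξ).1 ≠ 0 := h2
        simp only [affineChart_mk, Prod.smul_fst, Prod.smul_snd, smul_apply,
          map_smul, smul_eq_mul]
        field_simp
        linear_combination -hs
  right_inv' y _ := by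
    refine Prod.ext ((affineChart e).right_inv (mem_univ _)) ?_
    exact congrArg Prod.fst ((affineChart (dualCoord e)).right_inv (mem_univ _))
  open_source := ((affineChart e).open_source.preimage
      (continuous_fst.comp continuous_subtype_val)).inter
    ((affineChart (dualCoord e)).open_source.preimage
      (continuous_snd.comp continuous_subtype_val))
  open_target := isOpen_univ
  continuousOn_toFun := by
    refine ContinuousOn.prodMk ?_ ?_
    · exact (affineChart e).continuousOn_toFun.comp
        (continuous_fst.comp continuous_subtype_val).continuousOn fun s hs => hs.1
    · exact continuous_fst.comp_continuousOn ((affineChart (dualCoord e)).continuousOn_toFun.comp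
        (continuous_snd.comp continuous_subtype_val).continuousOn fun s hs => hs.2)
  continuousOn_invFun := by
    refine Continuous.continuousOn (Continuous.subtype_mk (Continuous.prodMk ?_ ?_) _)
    · exact (continuousOn_univ.mp (affineChart e).continuousOn_invFun).comp continuous_fst
    · exact (continuousOn_univ.mp (affineChart (dualCoord e)).continuousOn_invFun).comp
        (by fun_prop)

theorem exists_incidence_coordinates {x : V} (hx : x ≠ 0) {ξ : V →L[ℂ] ℂ} (hξ : ξ ≠ 0)
    (h : ξ x = 0) :
    ∃ e : V ≃L[ℂ] ℂ × MidCoord V × ℂ, (e x).1 ≠ 0 ∧ (dualCoord e ξ).1 ≠ 0 := by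
  obtain ⟨w, hw⟩ : ∃ w, ξ w = 1 := by
    obtain ⟨w, hw⟩ := ContinuousLinearMap.exists_ne_zero hξ
    exact ⟨(ξ w)⁻¹ • w, by simp [hw]⟩
  obtain ⟨f, hf, hfw⟩ : ∃ f : V →L[ℂ] ℂ, f x = 1 ∧ f w = 0 := by
    obtain ⟨f, hf⟩ := SeparatingDual.exists_eq_one (R := ℂ) hx
    exact ⟨f - f w • ξ, by simp [hf, h], by simp [hw]⟩
  let L : V →ₗ[ℂ] ℂ × ℂ := (f : V →ₗ[ℂ] ℂ).prod (ξ : V →ₗ[ℂ] ℂ)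
  have hL : ∀ v, L v = (f v, ξ v) := fun v => rfl
  have hsurj : Function.Surjective L := fun c => ⟨c.1 • x + c.2 • w, by simp [hL, hf, hfw, h, hw]⟩
  have hdim : finrank ℂ (LinearMap.ker L) = finrank ℂ (MidCoord V) := by
    have h1 := LinearMap.finrank_range_add_finrank_ker L
    rw [LinearMap.range_eq_top.mpr hsurj] at h1
    simp at h1 ⊢
    omega
  let g := LinearEquiv.ofFinrankEq _ _ hdim
  let q : V →ₗ[ℂ] LinearMap.ker L :=
    (LinearMap.id - (f : V →ₗ[ℂ] ℂ).smulRight x - (ξ : V →ₗ[ℂ] ℂ).smulRight w).codRestrict _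
      (fun v => by simp [hL, hf, hfw, h, hw])
  have hq : ∀ v, (q v : V) = v - f v • x - ξ v • w := fun v => rfl
  let e₁ : V ≃ₗ[ℂ] ℂ × MidCoord V × ℂ :=
    { (f : V →ₗ[ℂ] ℂ).prod ((g.toLinearMap ∘ₗ q).prod (ξ : V →ₗ[ℂ] ℂ)) with
      invFun p := p.1 • x + g.symm p.2.1 + p.2.2 • w
      left_inv v := by simp [hq]; abel
      right_inv p := by
        have hk : L (g.symm p.2.1 : V) = 0 := (g.symm p.2.1).2
        rw [hL, Prod.mk_eq_zero] at hk
        have h2 : q (p.1 • x + g.symm p.2.1 + p.2.2 • w) = g.symm p.2.1 := by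
          ext; simp [hq, hf, hfw, h, hw, hk]
        refine Prod.ext ?_ (Prod.ext ?_ ?_)
        · simp [hf, hfw, hk]
        · change g (q (p.1 • x + g.symm p.2.1 + p.2.2 • w)) = p.2.1
          rw [h2, g.apply_symm_apply]
        · simp [h, hw, hk] }
  refine ⟨e₁.toContinuousLinearEquiv, by simp [e₁, hf], ?_⟩
  change ξ (e₁.symm (0, 0, 1)) ≠ 0
  simp [e₁, hw]

/-- The incidence hypersurface as a complex manifold. -/
instance incidenceChartedSpace : ChartedSpace (IncidenceModel V) (incidence V) where
  atlas := range incidenceChart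
  chartAt s := incidenceChart
    (exists_incidence_coordinates s.1.1.rep_nonzero s.1.2.rep_nonzero s.2).choose
  mem_chart_source s := by
    have hs := (exists_incidence_coordinates s.1.1.rep_nonzero s.1.2.rep_nonzero s.2).choose_spec
    have h1 := (mk_mem_affineChart_source _ s.1.1.rep_nonzero).mpr hs.1
    have h2 := (mk_mem_affineChart_source _ s.1.2.rep_nonzero).mpr hs.2
    rw [Projectivization.mk_rep] at h1 h2
    exact ⟨h1, h2⟩
  chart_mem_atlas _ := mem_range_self _

instance incidenceIsManifold : IsManifold 𝓘(ℂ, IncidenceModel V) ω (incidence V) := by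
  refine isManifold_of_contDiffOn _ _ _ ?_
  rintro _ _ ⟨e, rfl⟩ ⟨e', rfl⟩
  let g : IncidenceModel V → ℂ × MidCoord V × ℂ := fun y => e' (e.symm (1, y.1))
  let k : IncidenceModel V → ℂ × (MidCoord V →L[ℂ] ℂ) × ℂ :=
    fun y => dualCoord e' ((dualCoord e).symm (1, y.2, -(y.2 y.1.1 + y.1.2)))
  have hg : ContDiff ℂ ω g := by fun_prop
  have hk : ContDiff ℂ ω k := by fun_prop
  have h : ContDiffOn ℂ ω (fun y => ((g y).1⁻¹ • (g y).2, ((k y).1⁻¹ • (k y).2).1))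
      {y | (g y).1 ≠ 0 ∧ (k y).1 ≠ 0} := by
    refine ContDiffOn.prodMk ?_ (ContDiffOn.fst ?_)
    · exact (hg.fst.contDiffOn.inv fun y hy => hy.1).smul hg.snd.contDiffOn
    · exact (hk.fst.contDiffOn.inv fun y hy => hy.2).smul hk.snd.contDiffOn
  refine (h.mono ?_).congr ?_
  · rintro y ⟨⟨-, hy⟩, -⟩
    exact hy
  · intro y hy
    rfl

end Incidence

/-! ### Punctured cotangent bundles and their symplectic structure -/

section Cotangent

variable (E : Type*) [NormedAddCommGroup E] [NormedSpace ℂ E]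
  (X : Type*) [TopologicalSpace X] [ChartedSpace E X] [IsManifold 𝓘(ℂ, E) ω X]

/-- The holomorphic cotangent bundle `T*X` of a complex manifold `X` modelled on `E`. -/
abbrev CotangentBundle : Type _ :=
  TotalSpace (E →L[ℂ] ℂ) fun x : X => TangentSpace 𝓘(ℂ, E) x →L[ℂ] ℂ

/-- The model with corners of `T*X`. -/
abbrev cotangentModel : ModelWithCorners ℂ (E × (E →L[ℂ] ℂ)) (ModelProd E (E →L[ℂ] ℂ)) :=
  𝓘(ℂ, E).prod 𝓘(ℂ, E →L[ℂ] ℂ)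

/-- The cotangent bundle with the zero section removed, an open submanifold of `T*X`. -/
def PuncturedCotangent : TopologicalSpace.Opens (CotangentBundle E X) where
  carrier := {z | z.2 ≠ 0}
  is_open' := by
    refine isOpen_iff_mem_nhds.mpr fun z hz => ?_
    let t := trivializationAt (E →L[ℂ] ℂ) (fun x : X => TangentSpace 𝓘(ℂ, E) x →L[ℂ] ℂ) z.1
    have hzt : z ∈ t.source := FiberBundle.mem_trivializationAt_proj_source
    have key : ∀ y ∈ t.source, ((t y).2 ≠ 0 ↔ y.2 ≠ 0) := by
      intro y hy
      have h := t.continuousLinearEquivAt_apply' (R := ℂ) y hy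
      rw [← h]
      exact (t.continuousLinearEquivAt ℂ y.1 (t.mem_source.mp hy)).map_ne_zero_iff
    have hcont : ContinuousAt (fun y => (t y).2) z :=
      (t.continuousOn.continuousAt (t.open_source.mem_nhds hzt)).snd
    filter_upwards [t.open_source.mem_nhds hzt,
      hcont.preimage_mem_nhds (isOpen_ne.mem_nhds ((key z hzt).mpr hz))] with y hy hy'
    exact (key y hy).mp hy'

variable {E X}

theorem mem_puncturedCotangent {z : CotangentBundle E X} :
    z ∈ PuncturedCotangent E X ↔ z.2 ≠ 0 := Iff.rfl

/-- The point `(x, p)` of the punctured cotangent bundle, where `p` is a nonzero covector at `x`. -/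
def PuncturedCotangent.mk (x : X) (p : TangentSpace 𝓘(ℂ, E) x →L[ℂ] ℂ) (hp : p ≠ 0) :
    PuncturedCotangent E X := ⟨⟨x, p⟩, mem_puncturedCotangent.mpr hp⟩

/-- The action of `ℂˣ` on the punctured cotangent bundle by scalar multiplication in the fibers. -/
instance : SMul ℂˣ (PuncturedCotangent E X) where
  smul c z := PuncturedCotangent.mk z.1.1 ((c : ℂ) • z.1.2)
    (smul_ne_zero c.ne_zero (mem_puncturedCotangent.mp z.2))

/-- The Liouville form `α` of the punctured cotangent bundle: `α_(x,p) v = p (dπ v)`, where `π` is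
the projection to `X`. -/
def liouvilleForm (z : PuncturedCotangent E X) :
    TangentSpace (cotangentModel E) z →L[ℂ] ℂ :=
  z.1.2 ∘L mfderiv (cotangentModel E) 𝓘(ℂ, E) (fun z : PuncturedCotangent E X => z.1.1) z

end Cotangent

section ExteriorDerivative

variable {E H : Type*} [NormedAddCommGroup E] [NormedSpace ℂ E] [TopologicalSpace H]
  {I : ModelWithCorners ℂ E H} [I.Boundaryless] {M : Type*} [TopologicalSpace M]
  [ChartedSpace H M]

/-- A `1`-form `θ` on a manifold, written in the preferred chart at `z₀`. -/
def oneFormInChart (θ : ∀ z : M, TangentSpace I z →L[ℂ] ℂ) (z₀ : M) (y : E) : E [⋀^Fin 1]→L[ℂ] ℂ :=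
  ContinuousAlternatingMap.ofSubsingleton ℂ E ℂ (0 : Fin 1)
    (θ ((extChartAt I z₀).symm y) ∘L mfderiv 𝓘(ℂ, E) I (extChartAt I z₀).symm y)

/-- The exterior derivative `dθ` of a `1`-form `θ` on a manifold, computed at each point `z₀` in
the preferred chart at `z₀` (through which `TangentSpace I z₀` is the model space). -/
def extDerivOneForm (θ : ∀ z : M, TangentSpace I z →L[ℂ] ℂ) (z₀ : M) (v w : TangentSpace I z₀) :
    ℂ :=
  extDeriv (oneFormInChart θ z₀) (extChartAt I z₀ z₀) (![v, w] : Fin 2 → E)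

end ExteriorDerivative

section Homogeneous

variable {E : Type*} [NormedAddCommGroup E] [NormedSpace ℂ E]
  {X : Type*} [TopologicalSpace X] [ChartedSpace E X] [IsManifold 𝓘(ℂ, E) ω X]
  {E' : Type*} [NormedAddCommGroup E'] [NormedSpace ℂ E']
  {Y : Type*} [TopologicalSpace Y] [ChartedSpace E' Y] [IsManifold 𝓘(ℂ, E') ω Y]

/-- The symplectic form `dα` of the punctured cotangent bundle. -/
def symplecticForm (z : PuncturedCotangent E X) (v w : TangentSpace (cotangentModel E) z) : ℂ :=
  extDerivOneForm (I := cotangentModel E) (M := PuncturedCotangent E X) liouvilleForm z v w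

/-- A biholomorphic map between punctured cotangent bundles is a homogeneous symplectic isomorphism
if it commutes with the actions of `ℂˣ` and preserves the Liouville forms and the symplectic
forms. -/
structure IsHomogeneousSymplectic
    (χ : Diffeomorph (cotangentModel E) (cotangentModel E')
      (PuncturedCotangent E X) (PuncturedCotangent E' Y) ω) : Prop where
  map_smul : ∀ (c : ℂˣ) (z : PuncturedCotangent E X), χ (c • z) = c • χ z
  liouville : ∀ (z : PuncturedCotangent E X) (v : TangentSpace (cotangentModel E) z),
    liouvilleForm (χ z) (mfderiv (cotangentModel E) (cotangentModel E') χ z v) = liouvilleForm z v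
  symplectic : ∀ (z : PuncturedCotangent E X) (v w : TangentSpace (cotangentModel E) z),
    symplecticForm (χ z) (mfderiv (cotangentModel E) (cotangentModel E') χ z v)
      (mfderiv (cotangentModel E) (cotangentModel E') χ z w) = symplecticForm z v w

end Homogeneous

/-! ### Contact structures -/

section Contact

variable {E H : Type*} [NormedAddCommGroup E] [NormedSpace ℂ E] [TopologicalSpace H]
  {I : ModelWithCorners ℂ E H} {M : Type*} [TopologicalSpace M] [ChartedSpace H M]
  {E' H' : Type*} [NormedAddCommGroup E'] [NormedSpace ℂ E'] [TopologicalSpace H']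
  {J : ModelWithCorners ℂ E' H'} {N : Type*} [TopologicalSpace N] [ChartedSpace H' N]

/-- A biholomorphic map is a contact isomorphism, with respect to fields `C`, `D` of tangent
hyperplanes, if its differential maps `C` onto `D`. -/
def IsContactIso (C : ∀ z : M, Submodule ℂ (TangentSpace I z))
    (D : ∀ z : N, Submodule ℂ (TangentSpace J z)) (Ψ : Diffeomorph I J M N ω) : Prop :=
  ∀ z, (C z).map (mfderiv I J Ψ z).toLinearMap = D (Ψ z)

end Contact

section ProjCotangent

variable (E : Type*) [NormedAddCommGroup E] [NormedSpace ℂ E]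
  (X : Type*) [TopologicalSpace X] [ChartedSpace E X] [IsManifold 𝓘(ℂ, E) ω X]

/-- The projectivized cotangent bundle `P*X` of a complex manifold `X`. -/
abbrev ProjCotangent : Type _ :=
  TotalSpace (ℙ ℂ (E →L[ℂ] ℂ)) fun x : X => ℙ ℂ (TangentSpace 𝓘(ℂ, E) x →L[ℂ] ℂ)

/-- The model with corners of `P*X`. -/
abbrev projCotangentModel : ModelWithCorners ℂ (E × ProjModel (E →L[ℂ] ℂ))
    (ModelProd E (ProjModel (E →L[ℂ] ℂ))) :=
  𝓘(ℂ, E).prod 𝓘(ℂ, ProjModel (E →L[ℂ] ℂ))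

variable {E X} [FiniteDimensional ℂ E]

/-- The canonical contact structure of `P*X`: at `(x, [p])` it is the hyperplane of the tangent
vectors `v` with `p (dπ v) = 0`, where `π` is the projection to `X`. -/
def projCotangentContact (z : ProjCotangent E X) :
    Submodule ℂ (TangentSpace (projCotangentModel E) z) :=
  (LinearMap.ker z.2.rep.toLinearMap).comap
    (mfderiv (projCotangentModel E) 𝓘(ℂ, E) (fun z : ProjCotangent E X => z.1) z).toLinearMap

end ProjCotangent

section IncidenceContact

variable {V : Type*} [NormedAddCommGroup V] [NormedSpace ℂ V] [FiniteDimensional ℂ V]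

/-- The canonical contact structure of the incidence hypersurface: the sum of the tangent spaces to
the fibers of the two projections to `ℙ` and `ℙ*`. At `([x], [ξ])` it is the hyperplane on which
`⟨ξ, dx⟩` vanishes (equivalently `⟨dξ, x⟩`, since `⟨ξ, dx⟩ + ⟨dξ, x⟩ = 0` along the
hypersurface). -/
def incidenceContact (s : incidence V) :
    Submodule ℂ (TangentSpace 𝓘(ℂ, IncidenceModel V) s) :=
  LinearMap.ker (mfderiv 𝓘(ℂ, IncidenceModel V) 𝓘(ℂ, ProjModel V)
    (fun s : incidence V => s.1.1) s).toLinearMap ⊔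
  LinearMap.ker (mfderiv 𝓘(ℂ, IncidenceModel V) 𝓘(ℂ, ProjModel (V →L[ℂ] ℂ))
    (fun s : incidence V => s.1.2) s).toLinearMap

end IncidenceContact

/-! ### The projection `V ∖ {0} → ℙ V` and pull-back of covectors -/

section Projection

variable (V : Type*) [NormedAddCommGroup V] [NormedSpace ℂ V]

/-- The open subset `V ∖ {0}` of `V`. -/
def Punctured : TopologicalSpace.Opens V := ⟨{0}ᶜ, isOpen_compl_singleton⟩

variable {V} in
/-- The projection `V ∖ {0} → ℙ V`. -/
def projMap (x : Punctured V) : ℙ ℂ V := Projectivization.mk ℂ x.1 x.2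

variable {V} [FiniteDimensional ℂ V]

/-- The covector `p` of `ℙ V` at `[x]` pulls back to the covector `ξ` of `V ∖ {0}` at `x`. -/
def PullsBackTo (x : Punctured V) (p : TangentSpace 𝓘(ℂ, ProjModel V) (projMap x) →L[ℂ] ℂ)
    (ξ : V →L[ℂ] ℂ) : Prop :=
  p ∘L mfderiv 𝓘(ℂ, V) 𝓘(ℂ, ProjModel V) projMap x = ξ

end Projection

end

/-! The differential of `V ∖ {0} → ℙ V` at `x` is onto with kernel `ℂ x`, so a nonzero covector of
`ℙ V` at `[x]` is the same thing as its pull-back `ξ` to `x`, a nonzero form with `ξ x = 0`.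
Replacing `x` by `c x` replaces `ξ` by `c⁻¹ ξ`. The punctured cotangent bundle is therefore the
space of pairs `(x, ξ)` of nonzero elements with `ξ x = 0`, modulo this action of `ℂˣ` (`IsCoLift`),
and in terms of local analytic lifts its Liouville form is `⟨ξ, dx⟩` (`liouvilleForm_of_isCoLift`).

In this description `V` and `V*` play symmetric roles. The rule `(x, ξ) ↦ (ξ, -x)` is compatible
with the action, and it pulls the Liouville form of the dual side back to `-⟨dξ, x⟩`. This equals
`⟨ξ, dx⟩`, because `⟨ξ, x⟩` vanishes identically (`liouvilleForm_dualMap`). The symplectic forms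
then correspond by naturality of the exterior derivative (`extDerivOneForm_mfderiv`). The rule is
treated for a pair of spaces in opposite duality (`IsSkewDual`), so that its inverse is a rule of
the same kind.

Dividing moreover by the scaling of `ξ` leaves the pairs `([x], [ξ])`, that is, the incidence
hypersurface. In normalized coordinates the sum of the two vertical tangent spaces is the kernel of
`⟨ξ, dx⟩` (`mem_incidenceContact_iff`), which is the contact hyperplane of the projectivized
cotangent bundle of `ℙ V`. The second contact isomorphism is the inverse of the first followed by
the projectivization of the symplectic one; that projectivization is contact because the contact
hyperplane is the kernel of the Liouville form pulled back by any local section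
(`isContactIso_projCotangentDiffeomorph`).

Analyticity is always checked on lifts: see `contMDiffAt_proj_of_lift`, `contMDiffAt_of_isCoLift`,
`exists_isCoLift` and `exists_local_section_projCotangentMk`. -/

noncomputable section

/-! ### Naturality of the exterior derivative of 1-forms. -/

section ExteriorDerivative

variable {E H : Type*} [NormedAddCommGroup E] [NormedSpace ℂ E] [TopologicalSpace H]
  {I : ModelWithCorners ℂ E H} [I.Boundaryless] {M : Type*} [TopologicalSpace M]
  [ChartedSpace H M] [IsManifold I ω M]
  {E' H' : Type*} [NormedAddCommGroup E'] [NormedSpace ℂ E'] [TopologicalSpace H']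
  {J : ModelWithCorners ℂ E' H'} [J.Boundaryless] {N : Type*} [TopologicalSpace N] [ChartedSpace H' N]
  [IsManifold J ω N]

/-- The exterior derivative of `1`-forms is natural. -/
theorem extDerivOneForm_mfderiv {f : M → N} (hf : ContMDiff I J ω f)
    {θ : ∀ z : M, TangentSpace I z →L[ℂ] ℂ} {θ' : ∀ z : N, TangentSpace J z →L[ℂ] ℂ}
    (h : ∀ z v, θ' (f z) (mfderiv I J f z v) = θ z v) (z₀ : M)
    (hθ' : DifferentiableAt ℂ (oneFormInChart θ' (f z₀)) (extChartAt J (f z₀) (f z₀)))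
    (v w : TangentSpace I z₀) :
    extDerivOneForm θ' (f z₀) (mfderiv I J f z₀ v) (mfderiv I J f z₀ w) =
      extDerivOneForm θ z₀ v w := by
  set g := writtenInExtChartAt I J z₀ f with hg
  set y₀ := extChartAt I z₀ z₀ with hy₀
  have hgy₀ : g y₀ = extChartAt J (f z₀) (f z₀) := by simp [g, y₀, writtenInExtChartAt]
  have hgC : ContDiffAt ℂ ω g y₀ := by
    have := (contMDiffAt_iff.1 (hf z₀)).2
    rwa [I.range_eq_univ, contDiffWithinAt_univ] at this
  have hmf : mfderiv I J f z₀ = fderiv ℂ g y₀ := by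
    rw [(hf z₀).mdifferentiableAt (by simp) |>.mfderiv, I.range_eq_univ, fderivWithin_univ]
  -- All tangent spaces of `N` are by definition `E'`, so forms at equal points can be compared on
  -- the same vector.
  have hθcongr : ∀ a b : N, a = b → ∀ u : E',
      (θ' a : E' →L[ℂ] ℂ) u = (θ' b : E' →L[ℂ] ℂ) u := by
    rintro a _ rfl u; rfl
  -- Near `y₀` the chart expression of `θ` is the pull-back of that of `θ'` by the chart expression
  -- `g` of `f`. The general statement then reduces to the pull-back formula in vector spaces.
  have hev : oneFormInChart θ z₀ =ᶠ[𝓝 y₀] fun y =>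
      (oneFormInChart θ' (f z₀) (g y)).compContinuousLinearMap (fderiv ℂ g y) := by
    have h1 : ∀ᶠ y in 𝓝 y₀, y ∈ (extChartAt I z₀).target := extChartAt_target_mem_nhds z₀
    have h2 : ∀ᶠ y in 𝓝 y₀, f ((extChartAt I z₀).symm y) ∈ (extChartAt J (f z₀)).source := by
      have hc : ContinuousAt (f ∘ (extChartAt I z₀).symm) y₀ :=
        ContinuousAt.comp (by exact hf.continuous.continuousAt) (continuousAt_extChartAt_symm z₀)
      refine hc.preimage_mem_nhds ?_
      simp only [Function.comp, hy₀, extChartAt_to_inv]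
      exact extChartAt_source_mem_nhds (I := J) (f z₀)
    filter_upwards [h1, h2] with y hy1 hy2
    have hsymm : MDifferentiableAt 𝓘(ℂ, E) I (extChartAt I z₀).symm y := by
      have := mdifferentiableWithinAt_extChartAt_symm (I := I) hy1
      rwa [I.range_eq_univ, mdifferentiableWithinAt_univ] at this
    have hgt : g y ∈ (extChartAt J (f z₀)).target := (extChartAt J (f z₀)).map_source hy2
    have hsymm' : MDifferentiableAt 𝓘(ℂ, E') J (extChartAt J (f z₀)).symm (g y) := by
      have := mdifferentiableWithinAt_extChartAt_symm (I := J) hgt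
      rwa [J.range_eq_univ, mdifferentiableWithinAt_univ] at this
    have hfd : MDifferentiableAt I J f ((extChartAt I z₀).symm y) :=
      (hf _).mdifferentiableAt (by simp)
    have hch : MDifferentiableAt J 𝓘(ℂ, E') (extChartAt J (f z₀))
        (f ((extChartAt I z₀).symm y)) :=
      mdifferentiableAt_extChartAt (by simpa using hy2)
    have hgd : MDifferentiableAt 𝓘(ℂ, E) 𝓘(ℂ, E') g y := MDifferentiableAt.comp y (by exact hch) (hfd.comp y hsymm)
    -- Differentiating this identity by the chain rule on both sides relates `fderiv ℂ g y` to the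
    -- differential of `f`.
    have hEq : (extChartAt J (f z₀)).symm ∘ g =ᶠ[𝓝 y] f ∘ (extChartAt I z₀).symm := by
      have hc : ContinuousAt (f ∘ (extChartAt I z₀).symm) y := (hfd.comp y hsymm).continuousAt
      have := hc.preimage_mem_nhds ((isOpen_extChartAt_source (I := J) (f z₀)).mem_nhds hy2)
      filter_upwards [this] with y' hy'
      exact (extChartAt J (f z₀)).left_inv hy'
    have hD := hEq.mfderiv_eq (I := 𝓘(ℂ, E)) (I' := J)
    rw [mfderiv_comp y hsymm' hgd, mfderiv_comp y hfd hsymm, mfderiv_eq_fderiv] at hD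
    ext u
    simp only [oneFormInChart, ContinuousAlternatingMap.compContinuousLinearMap_apply,
      ContinuousAlternatingMap.ofSubsingleton_apply_apply, Function.comp]
    change θ _ _ = _
    rw [← h]
    have := congrArg (fun A : E →L[ℂ] E' => A (u 0)) hD
    refine Eq.trans ?_ (hθcongr _ _ (hEq.self_of_nhds) _).symm
    exact congrArg _ this.symm
  rw [extDerivOneForm, extDerivOneForm, Filter.EventuallyEq.extDeriv_eq hev,
    extDeriv_pullback (r := ω) (by rwa [hgy₀]) hgC (by simp), hmf, ← hgy₀]
  rw [ContinuousAlternatingMap.compContinuousLinearMap_apply]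
  congr 1
  ext i
  fin_cases i <;> rfl
end ExteriorDerivative

/-! ### Local sections and analytic maps of projective spaces. -/

section AffineSection

variable {V : Type*} [NormedAddCommGroup V] [NormedSpace ℂ V]

/-- The local section of `V ∖ {0} → ℙ V` attached to an affine chart. -/
def affineSection {F : Type*} [NormedAddCommGroup F] [NormedSpace ℂ F]
    (e : V ≃L[ℂ] ℂ × F) (p : ℙ ℂ V) : V := e.symm (1, affineChart e p)

theorem affineSection_ne_zero {F : Type*} [NormedAddCommGroup F] [NormedSpace ℂ F]
    (e : V ≃L[ℂ] ℂ × F) (p : ℙ ℂ V) : affineSection e p ≠ 0 := by simp [affineSection]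

end AffineSection

section ProjectiveMaps

variable {V : Type*} [NormedAddCommGroup V] [NormedSpace ℂ V] [FiniteDimensional ℂ V]
  {EM HM M : Type*} [NormedAddCommGroup EM]
    [NormedSpace ℂ EM] [TopologicalSpace HM] {IM : ModelWithCorners ℂ EM HM} [TopologicalSpace M]
    [ChartedSpace HM M]

/-- Linear coordinates on `V` defining the preferred chart of `ℙ V` at `p`. -/
def preferredCoord (p : ℙ ℂ V) : V ≃L[ℂ] ℂ × ProjModel V :=
  (exists_affine_coordinates p.rep_nonzero).choose

theorem extChartAt_proj_apply (p q : ℙ ℂ V) :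
    extChartAt 𝓘(ℂ, ProjModel V) p q = affineChart (preferredCoord p) q := rfl

theorem preferredCoord_ne_zero {x : V} (hx : x ≠ 0) :
    (preferredCoord (Projectivization.mk ℂ x hx) x).1 ≠ 0 :=
  mem_chart_source (ProjModel V) (Projectivization.mk ℂ x hx)

/-- A map into projective space which locally lifts to an analytic map into `V` is analytic. -/
theorem contMDiffAt_proj_of_lift {g : M → ℙ ℂ V} {G : M → V} {m : M}
    (hG : ContMDiffAt IM 𝓘(ℂ, V) ω G m)
    (hg : ∀ᶠ x in 𝓝 m, ∃ h : G x ≠ 0, g x = Projectivization.mk ℂ (G x) h) :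
    ContMDiffAt IM 𝓘(ℂ, ProjModel V) ω g m := by
  obtain ⟨h0, hgm⟩ := hg.self_of_nhds
  set e := preferredCoord (g m)
  have he : (e (G m)).1 ≠ 0 := by
    have := preferredCoord_ne_zero h0
    rwa [← hgm] at this
  have heG : ContMDiffAt IM 𝓘(ℂ, ℂ × ProjModel V) ω (fun x => e (G x)) m :=
    e.contDiff.contMDiff.contMDiffAt.comp m hG
  have h1 : ContMDiffAt IM 𝓘(ℂ, ℂ) ω (fun x => (e (G x)).1) m :=
    contDiff_fst.contMDiff.contMDiffAt.comp m heG
  have h2 : ContMDiffAt IM 𝓘(ℂ, ProjModel V) ω (fun x => (e (G x)).2) m :=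
    contDiff_snd.contMDiff.contMDiffAt.comp m heG
  have hk : ContMDiffAt IM 𝓘(ℂ, ProjModel V) ω (fun x => (e (G x)).1⁻¹ • (e (G x)).2) m :=
    (h1.inv₀ he).smul h2
  have hs : ContMDiffAt 𝓘(ℂ, ProjModel V) 𝓘(ℂ, ProjModel V) ω (affineChart e).symm
      ((e (G m)).1⁻¹ • (e (G m)).2) :=
    contMDiffAt_symm_of_mem_maximalAtlas
      (IsManifold.subset_maximalAtlas (mem_range_self e)) (mem_univ _)
  -- Continuity of `g` is not assumed: `g` agrees near `m` with the inverse chart applied to the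
  -- affine coordinates of the lift.
  refine (hs.comp m hk).congr_of_eventuallyEq ?_
  have he' : ∀ᶠ x in 𝓝 m, (e (G x)).1 ≠ 0 := h1.continuousAt.eventually_ne he
  filter_upwards [hg, he'] with x ⟨hx, hgx⟩ hex
  rw [hgx]
  exact ((affineChart e).left_inv hex).symm

omit [FiniteDimensional ℂ V] in
theorem mk_affineSection {F : Type*} [NormedAddCommGroup F] [NormedSpace ℂ F]
    {e : V ≃L[ℂ] ℂ × F} {p : ℙ ℂ V} (hp : p ∈ (affineChart e).source) :
    Projectivization.mk ℂ (affineSection e p) (affineSection_ne_zero e p) = p :=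
  (affineChart e).left_inv hp

theorem affineChart_eq_of_section {F F' : Type*} [NormedAddCommGroup F] [NormedSpace ℂ F]
    [NormedAddCommGroup F'] [NormedSpace ℂ F'] {e : V ≃L[ℂ] ℂ × F} (e' : V ≃L[ℂ] ℂ × F') {p : ℙ ℂ V}
    (hp : p ∈ (affineChart e).source) :
    affineChart e' p = (e' (affineSection e p)).1⁻¹ • (e' (affineSection e p)).2 := by
  conv_lhs => rw [← mk_affineSection hp]
  rfl

/-- The model space `F` is arbitrary so that this covers the coordinates `incidenceCoord` and
`dualCoord`, whose target is not `ProjModel`. The transition from the preferred chart is a quotient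
of affine functions. -/
theorem contMDiffAt_affineChart {F : Type*} [NormedAddCommGroup F] [NormedSpace ℂ F]
    (e : V ≃L[ℂ] ℂ × F) {p : ℙ ℂ V} (hp : p ∈ (affineChart e).source) :
    ContMDiffAt 𝓘(ℂ, ProjModel V) 𝓘(ℂ, F) ω (affineChart e) p := by
  set e₀ := preferredCoord p
  have hp₀ : p ∈ (affineChart e₀).source := mem_chart_source (ProjModel V) p
  have h0 : ContMDiffAt 𝓘(ℂ, ProjModel V) 𝓘(ℂ, ProjModel V) ω (affineChart e₀) p :=
    contMDiffAt_of_mem_maximalAtlas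
      (IsManifold.subset_maximalAtlas (mem_range_self e₀)) hp₀
  have hne : (e (affineSection e₀ p)).1 ≠ 0 := by
    rw [← mk_affineSection hp₀] at hp
    exact hp
  have hk : ContDiffAt ℂ ω (fun y : ProjModel V => (e (e₀.symm (1, y))).1⁻¹ • (e (e₀.symm (1, y))).2)
      (affineChart e₀ p) := by
    refine ContDiffAt.smul (ContDiffAt.inv ?_ hne) ?_
    · exact ContDiff.contDiffAt (by fun_prop)
    · exact ContDiff.contDiffAt (by fun_prop)
  refine (hk.contMDiffAt.comp p h0).congr_of_eventuallyEq ?_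
  filter_upwards [(affineChart e₀).open_source.mem_nhds hp₀] with q hq
  exact affineChart_eq_of_section e hq

theorem contMDiffAt_affineSection {F : Type*} [NormedAddCommGroup F] [NormedSpace ℂ F]
    (e : V ≃L[ℂ] ℂ × F) {p : ℙ ℂ V} (hp : p ∈ (affineChart e).source) :
    ContMDiffAt 𝓘(ℂ, ProjModel V) 𝓘(ℂ, V) ω (affineSection e) p := by
  have : ContDiff ℂ ω fun y : F => e.symm (1, y) := by fun_prop
  exact this.contMDiff.contMDiffAt.comp p (contMDiffAt_affineChart e hp)

theorem contMDiff_projMap : ContMDiff 𝓘(ℂ, V) 𝓘(ℂ, ProjModel V) ω (projMap (V := V)) :=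
  fun x => contMDiffAt_proj_of_lift (G := fun x : Punctured V => (x : V))
    (contMDiff_subtype_val x) (Filter.Eventually.of_forall fun x => ⟨x.2, rfl⟩)

end ProjectiveMaps

theorem contMDiffAt_subtypeVal_comp_iff_of_opens {E H E' H' M M' : Type*} [NormedAddCommGroup E] [NormedSpace ℂ E]
    [TopologicalSpace H] {I : ModelWithCorners ℂ E H} [TopologicalSpace M] [ChartedSpace H M]
    [NormedAddCommGroup E'] [NormedSpace ℂ E'] [TopologicalSpace H'] {I' : ModelWithCorners ℂ E' H'}
    [TopologicalSpace M'] [ChartedSpace H' M'] {n : ℕ∞ω} {U : TopologicalSpace.Opens M'}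
    {f : M → U} {x : M} :
    ContMDiffAt I I' n (fun m => (f m : M')) x ↔ ContMDiffAt I I' n f x :=
  ChartedSpace.liftPropWithinAt_subtypeVal_comp_iff ..

/-! ### Fiber coordinates on cotangent bundles. -/

section Cotangent

variable {E : Type*} [NormedAddCommGroup E] [NormedSpace ℂ E]
  {X : Type*} [TopologicalSpace X] [ChartedSpace E X]

/-- The fiber coordinate of a covector `p` at `x` in the preferred chart at `x₀`. -/
def covectorCoord (x₀ x : X) (p : TangentSpace 𝓘(ℂ, E) x →L[ℂ] ℂ) : E →L[ℂ] ℂ :=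
  p ∘L mfderiv 𝓘(ℂ, E) 𝓘(ℂ, E) (extChartAt 𝓘(ℂ, E) x₀).symm (extChartAt 𝓘(ℂ, E) x₀ x)

variable [IsManifold 𝓘(ℂ, E) ω X]

/-- The trivialization of a bundle of homomorphisms precomposes with the inverse trivialization of
the tangent bundle, which is the differential of the inverse chart. The trivial line bundle
contributes the identity. -/
theorem trivializationAt_cotangent_apply {x₀ : X} {z : CotangentBundle E X}
    (hz : z.1 ∈ (chartAt E x₀).source) :
    trivializationAt (E →L[ℂ] ℂ) (fun x : X => TangentSpace 𝓘(ℂ, E) x →L[ℂ] ℂ) x₀ z =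
      (z.1, covectorCoord x₀ z.1 z.2) := by
  erw [hom_trivializationAt_apply]
  congr 1
  rw [ContinuousLinearMap.inCoordinates, covectorCoord, TangentBundle.symmL_trivializationAt hz]
  rw [ModelWithCorners.range_eq_univ, mfderivWithin_univ]
  ext v
  simp

theorem contMDiffAt_cotangentBundle_iff {EM HM M : Type*} [NormedAddCommGroup EM] [NormedSpace ℂ EM]
    [TopologicalSpace HM] {IM : ModelWithCorners ℂ EM HM} [TopologicalSpace M] [ChartedSpace HM M]
    {f : M → CotangentBundle E X} {m : M} :
    ContMDiffAt IM (cotangentModel E) ω f m ↔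
      ContMDiffAt IM 𝓘(ℂ, E) ω (fun x => (f x).1) m ∧
      ContMDiffAt IM 𝓘(ℂ, E →L[ℂ] ℂ) ω (fun x => covectorCoord (f m).1 (f x).1 (f x).2) m := by
  rw [contMDiffAt_totalSpace]
  refine and_congr_right fun h => ?_
  refine Filter.EventuallyEq.contMDiffAt_iff ?_
  filter_upwards [h.continuousAt.preimage_mem_nhds
    ((chartAt E (f m).1).open_source.mem_nhds (mem_chart_source E (f m).1))] with x hx
  rw [trivializationAt_cotangent_apply hx]

theorem contMDiff_puncturedCotangent_proj :
    ContMDiff (cotangentModel E) 𝓘(ℂ, E) ω (fun z : PuncturedCotangent E X => z.1.1) :=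
  fun z => (contMDiffAt_cotangentBundle_iff.1
    (contMDiff_subtype_val (U := PuncturedCotangent E X) z)).1

theorem contMDiffAt_covectorCoord (z₀ : PuncturedCotangent E X) :
    ContMDiffAt (cotangentModel E) 𝓘(ℂ, E →L[ℂ] ℂ) ω
      (fun z : PuncturedCotangent E X => covectorCoord z₀.1.1 z.1.1 z.1.2) z₀ :=
  (contMDiffAt_cotangentBundle_iff.1
    (contMDiff_subtype_val (U := PuncturedCotangent E X) z₀)).2

theorem contMDiffAt_puncturedCotangent_iff {EM HM M : Type*} [NormedAddCommGroup EM]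
    [NormedSpace ℂ EM] [TopologicalSpace HM] {IM : ModelWithCorners ℂ EM HM} [TopologicalSpace M]
    [ChartedSpace HM M] {f : M → PuncturedCotangent E X} {m : M} :
    ContMDiffAt IM (cotangentModel E) ω f m ↔
      ContMDiffAt IM 𝓘(ℂ, E) ω (fun x => (f x).1.1) m ∧
      ContMDiffAt IM 𝓘(ℂ, E →L[ℂ] ℂ) ω
        (fun x => covectorCoord (f m).1.1 (f x).1.1 (f x).1.2) m := by
  rw [← contMDiffAt_subtypeVal_comp_iff_of_opens, contMDiffAt_cotangentBundle_iff]

theorem mfderiv_chart_symm_surjective {x₀ x : X} (hx : x ∈ (chartAt E x₀).source) :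
    Function.Surjective (mfderiv 𝓘(ℂ, E) 𝓘(ℂ, E) (extChartAt 𝓘(ℂ, E) x₀).symm
      (extChartAt 𝓘(ℂ, E) x₀ x) : E → E) := by
  have := isInvertible_mfderivWithin_extChartAt_symm (I := 𝓘(ℂ, E)) (x := x₀)
    (y := extChartAt 𝓘(ℂ, E) x₀ x) ((extChartAt 𝓘(ℂ, E) x₀).map_source (by simpa using hx))
  rw [ModelWithCorners.range_eq_univ, mfderivWithin_univ] at this
  exact this.bijective.surjective

theorem covectorCoord_ne_zero {x₀ x : X} (hx : x ∈ (chartAt E x₀).source)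
    {p : TangentSpace 𝓘(ℂ, E) x →L[ℂ] ℂ} (hp : p ≠ 0) : covectorCoord x₀ x p ≠ 0 := by
  intro h
  apply hp
  ext v
  obtain ⟨u, rfl⟩ := mfderiv_chart_symm_surjective hx v
  exact congrArg (fun q : E →L[ℂ] ℂ => q u) h

/-- Covectors at a priori different points are compared on the model space, which every tangent
space is by definition; this avoids heterogeneous equality. -/
theorem puncturedCotangent_ext {z z' : PuncturedCotangent E X} (h : z.1.1 = z'.1.1)
    (h' : ∀ v : E, (z.1.2 : E →L[ℂ] ℂ) v = (z'.1.2 : E →L[ℂ] ℂ) v) : z = z' := by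
  obtain ⟨⟨x, p⟩, hz⟩ := z
  obtain ⟨⟨x', p'⟩, hz'⟩ := z'
  obtain rfl : x = x' := h
  obtain rfl : p = p' := ContinuousLinearMap.ext h'
  rfl



theorem trivFiberEquiv_cotangent {x₀ x : X} (hx : x ∈ (chartAt E x₀).source)
    (p : TangentSpace 𝓘(ℂ, E) x →L[ℂ] ℂ) :
    trivFiberEquiv (trivializationAt (E →L[ℂ] ℂ)
      (fun x : X => TangentSpace 𝓘(ℂ, E) x →L[ℂ] ℂ) x₀) x p = covectorCoord x₀ x p := by
  have hb : x ∈ (trivializationAt (E →L[ℂ] ℂ)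
      (fun x : X => TangentSpace 𝓘(ℂ, E) x →L[ℂ] ℂ) x₀).baseSet := by
    erw [hom_trivializationAt_baseSet]
    exact ⟨by simpa using hx, mem_univ _⟩
  rw [trivFiberEquiv, dif_pos hb, Trivialization.continuousLinearEquivAt_apply]
  exact congrArg Prod.snd (trivializationAt_cotangent_apply (z := ⟨x, p⟩) hx)

variable [FiniteDimensional ℂ E]

omit [FiniteDimensional ℂ E] in
theorem trivializationAt_projCotangent_mk {x₀ x : X} (hx : x ∈ (chartAt E x₀).source)
    {p : TangentSpace 𝓘(ℂ, E) x →L[ℂ] ℂ} (hp : p ≠ 0) :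
    trivializationAt (ℙ ℂ (E →L[ℂ] ℂ)) (fun x : X => ℙ ℂ (TangentSpace 𝓘(ℂ, E) x →L[ℂ] ℂ)) x₀
      ⟨x, Projectivization.mk ℂ p hp⟩ =
        (x, Projectivization.mk ℂ (covectorCoord x₀ x p) (covectorCoord_ne_zero hx hp)) := by
  change (x, projEquiv (trivFiberEquiv _ x) _) = _
  rw [projEquiv_mk]
  simp only [trivFiberEquiv_cotangent hx]
end Cotangent

/-! ### Projectivized cotangent bundles and their contact structure. -/

section ProjCotangent

variable {E : Type*} [NormedAddCommGroup E] [NormedSpace ℂ E]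
  {X : Type*} [TopologicalSpace X] [ChartedSpace E X] [IsManifold 𝓘(ℂ, E) ω X]
  [FiniteDimensional ℂ E]

/-- The charts of the total space are a trivialization followed by a product of charts, so
continuity and analyticity both split into a base part and a fiber part. -/
theorem contMDiffAt_projCotangent_iff {EM HM M : Type*} [NormedAddCommGroup EM]
    [NormedSpace ℂ EM] [TopologicalSpace HM] {IM : ModelWithCorners ℂ EM HM} [TopologicalSpace M]
    [ChartedSpace HM M] {f : M → ProjCotangent E X} {m : M} :
    ContMDiffAt IM (projCotangentModel E) ω f m ↔
      ContMDiffAt IM 𝓘(ℂ, E) ω (fun x => (f x).1) m ∧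
      ContMDiffAt IM 𝓘(ℂ, ProjModel (E →L[ℂ] ℂ)) ω
        (fun x => (trivializationAt (ℙ ℂ (E →L[ℂ] ℂ))
          (fun x : X => ℙ ℂ (TangentSpace 𝓘(ℂ, E) x →L[ℂ] ℂ)) (f m).1 (f x)).2) m := by
  rw [contMDiffAt_iff_target, FiberBundle.continuousAt_totalSpace]
  rw [contMDiffAt_iff_target (f := fun x => (f x).1), contMDiffAt_iff_target (f := fun x =>
    (trivializationAt (ℙ ℂ (E →L[ℂ] ℂ))
      (fun x : X => ℙ ℂ (TangentSpace 𝓘(ℂ, E) x →L[ℂ] ℂ)) (f m).1 (f x)).2)]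
  have key : ContMDiffAt IM 𝓘(ℂ, E × ProjModel (E →L[ℂ] ℂ)) ω
      (extChartAt (projCotangentModel E) (f m) ∘ f) m ↔
      ContMDiffAt IM 𝓘(ℂ, E) ω (extChartAt 𝓘(ℂ, E) (f m).1 ∘ fun x => (trivializationAt (ℙ ℂ (E →L[ℂ] ℂ))
      (fun x : X => ℙ ℂ (TangentSpace 𝓘(ℂ, E) x →L[ℂ] ℂ)) (f m).1 (f x)).1) m ∧
      ContMDiffAt IM 𝓘(ℂ, ProjModel (E →L[ℂ] ℂ)) ω
        (extChartAt 𝓘(ℂ, ProjModel (E →L[ℂ] ℂ)) ((trivializationAt (ℙ ℂ (E →L[ℂ] ℂ))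
          (fun x : X => ℙ ℂ (TangentSpace 𝓘(ℂ, E) x →L[ℂ] ℂ)) (f m).1 (f m)).2) ∘ fun x => (trivializationAt (ℙ ℂ (E →L[ℂ] ℂ))
          (fun x : X => ℙ ℂ (TangentSpace 𝓘(ℂ, E) x →L[ℂ] ℂ)) (f m).1 (f x)).2) m := by
    -- The preferred chart at `f m` unfolds definitionally to the pair of the two coordinate maps.
    exact contMDiffAt_prod_module_iff _
  rw [key]
  exact ⟨fun h => ⟨⟨h.1.1, h.2.1⟩, ⟨h.1.2, h.2.2⟩⟩, fun h => ⟨⟨h.1.1, h.2.1⟩, ⟨h.1.2, h.2.2⟩⟩⟩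

theorem contMDiff_projCotangent_proj :
    ContMDiff (projCotangentModel E) 𝓘(ℂ, E) ω (fun z : ProjCotangent E X => z.1) :=
  fun _ => (contMDiffAt_projCotangent_iff.1 contMDiffAt_id).1

/-- The quotient map from the punctured cotangent bundle to the projectivized cotangent bundle. -/
def projCotangentMk (z : PuncturedCotangent E X) : ProjCotangent E X :=
  ⟨z.1.1, Projectivization.mk ℂ z.1.2 z.2⟩

theorem contMDiff_projCotangentMk :
    ContMDiff (cotangentModel E) (projCotangentModel E) ω
      (projCotangentMk (E := E) (X := X)) := by
  intro z₀
  refine contMDiffAt_projCotangent_iff.2 ⟨contMDiff_puncturedCotangent_proj z₀, ?_⟩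
  refine contMDiffAt_proj_of_lift (contMDiffAt_covectorCoord z₀) ?_
  have : ∀ᶠ z : PuncturedCotangent E X in 𝓝 z₀, z.1.1 ∈ (chartAt E z₀.1.1).source :=
    (contMDiff_puncturedCotangent_proj z₀).continuousAt.preimage_mem_nhds
      ((chartAt E z₀.1.1).open_source.mem_nhds (mem_chart_source E _))
  filter_upwards [this] with z hz
  exact ⟨covectorCoord_ne_zero hz z.2,
    congrArg Prod.snd (trivializationAt_projCotangent_mk hz z.2)⟩

omit [FiniteDimensional ℂ E] in
theorem projCotangentMk_smul (c : ℂˣ) (z : PuncturedCotangent E X) :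
    projCotangentMk (c • z) = (projCotangentMk z) :=
  congrArg (TotalSpace.mk z.1.1)
    ((Projectivization.mk_eq_mk_iff ℂ _ _ _ _).2 ⟨c, rfl⟩)

theorem projCotangentMk_eq_iff {z w : PuncturedCotangent E X} :
    (projCotangentMk z) = (projCotangentMk w) ↔ ∃ c : ℂˣ, c • w = z := by
  constructor
  · obtain ⟨⟨x, p⟩, hz⟩ := z
    obtain ⟨⟨x', p'⟩, hw⟩ := w
    intro h
    obtain rfl : x = x' := congrArg TotalSpace.proj h
    have h' := TotalSpace.mk_inj.1 h
    obtain ⟨c, hc⟩ := (Projectivization.mk_eq_mk_iff ℂ _ _ _ _).1 h'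
    refine ⟨c, ?_⟩
    apply Subtype.ext
    exact congrArg (TotalSpace.mk x) hc
  · rintro ⟨c, rfl⟩
    exact projCotangentMk_smul c w

/-- A representative of a point of the projectivized cotangent bundle. -/
def ProjCotangent.lift (z : ProjCotangent E X) : PuncturedCotangent E X :=
  PuncturedCotangent.mk z.1 z.2.rep z.2.rep_nonzero

omit [FiniteDimensional ℂ E] in
theorem projCotangentMk_lift (z : ProjCotangent E X) : projCotangentMk (ProjCotangent.lift z) = z :=
  congrArg (TotalSpace.mk z.1) z.2.mk_rep

/-- In a local trivialization of the cotangent bundle, a line of covectors is represented by its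
element with one linear coordinate equal to `1`, as provided by `affineSection`. -/
theorem exists_local_section_projCotangentMk (z₀ : ProjCotangent E X) :
    ∃ s : ProjCotangent E X → PuncturedCotangent E X,
      ContMDiffAt (projCotangentModel E) (cotangentModel E) ω s z₀ ∧
      ∀ᶠ z in 𝓝 z₀, projCotangentMk (s z) = z := by
  let t := trivializationAt (E →L[ℂ] ℂ) (fun x : X => TangentSpace 𝓘(ℂ, E) x →L[ℂ] ℂ) z₀.1
  let T := trivializationAt (ℙ ℂ (E →L[ℂ] ℂ))
    (fun x : X => ℙ ℂ (TangentSpace 𝓘(ℂ, E) x →L[ℂ] ℂ)) z₀.1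
  let a := preferredCoord (T z₀).2
  have ha : (T z₀).2 ∈ (affineChart a).source := mem_chart_source (ProjModel (E →L[ℂ] ℂ)) _
  obtain ⟨h1, h2⟩ := contMDiffAt_projCotangent_iff.1
    (contMDiffAt_id (I := projCotangentModel E) (x := z₀) (n := ω))
  let s : ProjCotangent E X → PuncturedCotangent E X := fun z =>
    PuncturedCotangent.mk z.1 ((trivFiberEquiv t z.1).symm (affineSection a (T z).2))
      (by simpa using affineSection_ne_zero a (T z).2)
  -- The section is built from the trivialization, so its fiber coordinate is the affine section
  -- itself, which is known to be analytic.
  have hs : ∀ᶠ z in 𝓝 z₀, covectorCoord z₀.1 z.1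
      ((trivFiberEquiv t z.1).symm (affineSection a (T z).2)) = affineSection a (T z).2 := by
    have : ∀ᶠ z : ProjCotangent E X in 𝓝 z₀, z.1 ∈ (chartAt E z₀.1).source :=
      h1.continuousAt.preimage_mem_nhds
        ((chartAt E z₀.1).open_source.mem_nhds (mem_chart_source E _))
    filter_upwards [this] with z hz
    rw [← trivFiberEquiv_cotangent hz]
    exact (trivFiberEquiv t z.1).apply_symm_apply _
  refine ⟨s, ?_, ?_⟩
  · refine contMDiffAt_puncturedCotangent_iff.2 ⟨h1, ?_⟩
    have h3 : ContMDiffAt (projCotangentModel E) 𝓘(ℂ, E →L[ℂ] ℂ) ω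
        (fun z : ProjCotangent E X => affineSection a (T z).2) z₀ :=
      ContMDiffAt.comp (g := affineSection a) (f := fun z : ProjCotangent E X => (T z).2) z₀
        (contMDiffAt_affineSection a ha) h2
    exact h3.congr_of_eventuallyEq (by exact hs)
  · have : ∀ᶠ z : ProjCotangent E X in 𝓝 z₀, (T z).2 ∈ (affineChart a).source :=
      h2.continuousAt.preimage_mem_nhds ((affineChart a).open_source.mem_nhds ha)
    filter_upwards [this] with z hz
    refine congrArg (TotalSpace.mk z.1) ?_
    apply (projEquiv (trivFiberEquiv t z.1)).injective
    refine Eq.trans ?_ (mk_affineSection hz)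
    refine (projEquiv_mk (trivFiberEquiv t z.1)
      ((trivFiberEquiv t z.1).symm (affineSection a (T z).2)) (s z).2).trans ?_
    congr 1
    exact (trivFiberEquiv t z.1).apply_symm_apply _

/-- Proportional covectors have the same kernel, so the representative chosen in the definition may
be replaced by any other. -/
theorem mem_projCotangentContact_iff {w : PuncturedCotangent E X} {z : ProjCotangent E X}
    (h : projCotangentMk w = z) {v : TangentSpace (projCotangentModel E) z} :
    v ∈ projCotangentContact z ↔
      (w.1.2 : E →L[ℂ] ℂ) (mfderiv (projCotangentModel E) 𝓘(ℂ, E)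
        (fun z : ProjCotangent E X => z.1) z v) = 0 := by
  subst h
  obtain ⟨c, hc⟩ := Projectivization.exists_smul_eq_mk_rep ℂ w.1.2 w.2
  change (Projectivization.mk ℂ w.1.2 w.2).rep (mfderiv (projCotangentModel E) 𝓘(ℂ, E)
    (fun z : ProjCotangent E X => z.1) (projCotangentMk w) v) = 0 ↔ _
  rw [← hc]
  exact (smul_eq_zero_iff_right (R := ℂ) c.ne_zero)

/-- The differential is onto, hence the image of the preimage of a subspace is the whole subspace.
This turns an equality of images into a pointwise equivalence. -/
theorem isContactIso_of_mem_iff {E H : Type*} [NormedAddCommGroup E] [NormedSpace ℂ E] [TopologicalSpace H]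
    {I : ModelWithCorners ℂ E H} {M : Type*} [TopologicalSpace M] [ChartedSpace H M]
    {E' H' : Type*} [NormedAddCommGroup E'] [NormedSpace ℂ E'] [TopologicalSpace H']
    {J : ModelWithCorners ℂ E' H'} {N : Type*} [TopologicalSpace N] [ChartedSpace H' N]
    {C : ∀ z : M, Submodule ℂ (TangentSpace I z)}
    {D : ∀ z : N, Submodule ℂ (TangentSpace J z)} {Ψ : Diffeomorph I J M N ω}
    (h : ∀ z v, v ∈ C z ↔ mfderiv I J Ψ z v ∈ D (Ψ z)) : IsContactIso C D Ψ := by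
  intro z
  have hC : C z = (D (Ψ z)).comap (mfderiv I J Ψ z).toLinearMap := by
    ext v; exact h z v
  rw [hC]
  refine Submodule.map_comap_eq_of_surjective ?_ _
  exact (Ψ.mfderivToContinuousLinearEquiv (by simp) z).surjective

end ProjCotangent

/-! ### Homogeneous maps descend to projectivized cotangent bundles. -/

section InducedMap

variable {E : Type*} [NormedAddCommGroup E] [NormedSpace ℂ E] [FiniteDimensional ℂ E]
  {X : Type*} [TopologicalSpace X] [ChartedSpace E X] [IsManifold 𝓘(ℂ, E) ω X]
  {E' : Type*} [NormedAddCommGroup E'] [NormedSpace ℂ E'] [FiniteDimensional ℂ E']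
  {Y : Type*} [TopologicalSpace Y] [ChartedSpace E' Y] [IsManifold 𝓘(ℂ, E') ω Y]

/-- Near any point `f` is `g` composed with a local analytic section of the quotient map. -/
theorem contMDiff_of_comp_projCotangentMk {EN HN N : Type*} [NormedAddCommGroup EN]
    [NormedSpace ℂ EN] [TopologicalSpace HN] {IN : ModelWithCorners ℂ EN HN} [TopologicalSpace N]
    [ChartedSpace HN N] {f : ProjCotangent E X → N} {g : PuncturedCotangent E X → N}
    (hg : ContMDiff (cotangentModel E) IN ω g) (h : ∀ z, f (projCotangentMk z) = g z) :
    ContMDiff (projCotangentModel E) IN ω f := by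
  intro z₀
  obtain ⟨s, hs, hsec⟩ := exists_local_section_projCotangentMk z₀
  refine (ContMDiffAt.comp z₀ (hg (s z₀)) hs).congr_of_eventuallyEq ?_
  filter_upwards [hsec] with z hz
  rw [Function.comp, ← h, hz]

/-- The map of projectivized cotangent bundles induced by a map of punctured cotangent bundles. -/
def projCotangentMap (χ : PuncturedCotangent E X → PuncturedCotangent E' Y)
    (z : ProjCotangent E X) : ProjCotangent E' Y := projCotangentMk (χ (ProjCotangent.lift z))

theorem projCotangentMap_mk {χ : PuncturedCotangent E X → PuncturedCotangent E' Y}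
    (hχ : ∀ (c : ℂˣ) z, χ (c • z) = c • χ z) (z : PuncturedCotangent E X) :
    projCotangentMap χ (projCotangentMk z) = projCotangentMk (χ z) := by
  obtain ⟨c, hc⟩ := projCotangentMk_eq_iff.1 (projCotangentMk_lift (projCotangentMk z))
  rw [projCotangentMap, ← hc, hχ, projCotangentMk_smul]

/-- The isomorphism of projectivized cotangent bundles induced by a homogeneous isomorphism of
punctured cotangent bundles. -/
def projCotangentDiffeomorph
    (χ : Diffeomorph (cotangentModel E) (cotangentModel E')
      (PuncturedCotangent E X) (PuncturedCotangent E' Y) ω)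
    (hχ : ∀ (c : ℂˣ) z, χ (c • z) = c • χ z) :
    Diffeomorph (projCotangentModel E) (projCotangentModel E')
      (ProjCotangent E X) (ProjCotangent E' Y) ω :=
  have hχ' : ∀ (c : ℂˣ) z, χ.symm (c • z) = c • χ.symm z := fun c z => by
    apply χ.injective
    change χ _ = χ _
    rw [hχ, χ.apply_symm_apply, χ.apply_symm_apply]
  { toFun := projCotangentMap χ
    invFun := projCotangentMap χ.symm
    left_inv z := by
      rw [← projCotangentMk_lift z, projCotangentMap_mk hχ, projCotangentMap_mk hχ',
        χ.symm_apply_apply]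
    right_inv z := by
      rw [← projCotangentMk_lift z, projCotangentMap_mk hχ', projCotangentMap_mk hχ,
        χ.apply_symm_apply]
    contMDiff_toFun := contMDiff_of_comp_projCotangentMk
      (contMDiff_projCotangentMk.comp χ.contMDiff) (projCotangentMap_mk hχ)
    contMDiff_invFun := contMDiff_of_comp_projCotangentMk
      (contMDiff_projCotangentMk.comp χ.symm.contMDiff) (projCotangentMap_mk hχ') }

theorem projCotangentDiffeomorph_mk
    {χ : Diffeomorph (cotangentModel E) (cotangentModel E')
      (PuncturedCotangent E X) (PuncturedCotangent E' Y) ω}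
    (hχ : ∀ (c : ℂˣ) z, χ (c • z) = c • χ z) (z : PuncturedCotangent E X) :
    projCotangentDiffeomorph χ hχ (projCotangentMk z) = projCotangentMk (χ z) :=
  projCotangentMap_mk hχ z

omit [FiniteDimensional ℂ E] in
/-- The Liouville form in terms of a map to the projectivized cotangent bundle. -/
theorem liouvilleForm_mfderiv {EN HN N : Type*} [NormedAddCommGroup EN]
    [NormedSpace ℂ EN] [TopologicalSpace HN] {IN : ModelWithCorners ℂ EN HN} [TopologicalSpace N]
    [ChartedSpace HN N] {f : N → PuncturedCotangent E X} {x : N}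
    (hf : MDifferentiableAt IN (cotangentModel E) f x) (v : TangentSpace IN x) :
    liouvilleForm (f x) (mfderiv IN (cotangentModel E) f x v) =
      (f x).1.2 (mfderiv IN 𝓘(ℂ, E) (fun y => (f y).1.1) x v) := by
  have := mfderiv_comp x ((contMDiff_puncturedCotangent_proj (f x)).mdifferentiableAt
    (by simp)) hf
  change (f x).1.2 _ = _
  refine congrArg (f x).1.2 ?_
  exact (congrArg (fun A : EN →L[ℂ] E => A v) this).symm

/-- For a local section `s` of the quotient map, the contact hyperplane is the kernel of `s*α`. The
map `χ ∘ s` lifts `Φ` to the target, so the preimage of the target hyperplane under `dΦ` is the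
kernel of `(χ ∘ s)*α = s*(χ*α) = s*α`. -/
theorem isContactIso_projCotangentDiffeomorph
    {χ : Diffeomorph (cotangentModel E) (cotangentModel E')
      (PuncturedCotangent E X) (PuncturedCotangent E' Y) ω}
    (hχ : IsHomogeneousSymplectic χ) :
    IsContactIso projCotangentContact projCotangentContact
      (projCotangentDiffeomorph χ hχ.map_smul) := by
  set Φ := projCotangentDiffeomorph χ hχ.map_smul
  refine isContactIso_of_mem_iff fun z₀ v => ?_
  obtain ⟨s, hs, hsec⟩ := exists_local_section_projCotangentMk z₀
  have hsd := hs.mdifferentiableAt (by simp)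
  have hχd : MDifferentiableAt (cotangentModel E) (cotangentModel E') χ (s z₀) :=
    (χ.contMDiff _).mdifferentiableAt (by simp)
  have hΦd : MDifferentiableAt (projCotangentModel E) (projCotangentModel E') Φ z₀ :=
    (Φ.contMDiff _).mdifferentiableAt (by simp)
  have hz₀ := hsec.self_of_nhds
  have h1 := liouvilleForm_mfderiv hsd v
  have h2 := liouvilleForm_mfderiv (hχd.comp z₀ hsd) v
  have h3 := hχ.liouville (s z₀) (mfderiv (projCotangentModel E) (cotangentModel E) s z₀ v)
  have h4 := congrArg (fun A : E × ProjModel (E →L[ℂ] ℂ) →L[ℂ] E' × (E' →L[ℂ] ℂ) => A v)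
    (mfderiv_comp z₀ hχd hsd)
  -- Near `z₀` the section `s` covers the identity and `χ ∘ s` covers `Φ`; differentiating these
  -- identities compares the base components of the differentials.
  have e1 : (fun y => (s y).1.1) =ᶠ[𝓝 z₀] fun z : ProjCotangent E X => z.1 := by
    filter_upwards [hsec] with z hz
    exact congrArg TotalSpace.proj hz
  have e2 : (fun y => (χ (s y)).1.1) =ᶠ[𝓝 z₀] (fun z : ProjCotangent E' Y => z.1) ∘ Φ := by
    filter_upwards [hsec] with z hz
    have := projCotangentDiffeomorph_mk hχ.map_smul (s z)
    rw [hz] at this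
    exact (congrArg TotalSpace.proj this).symm
  have d1 := e1.mfderiv_eq (I := projCotangentModel E) (I' := 𝓘(ℂ, E))
  have d2 := e2.mfderiv_eq (I := projCotangentModel E) (I' := 𝓘(ℂ, E'))
  rw [mfderiv_comp z₀ ((contMDiff_projCotangent_proj _).mdifferentiableAt (by simp)) hΦd] at d2
  rw [mem_projCotangentContact_iff hz₀, mem_projCotangentContact_iff
    (w := χ (s z₀)) (by rw [← projCotangentDiffeomorph_mk hχ.map_smul, hz₀])]
  have h5 : ((χ (s z₀)).1.2 : E' →L[ℂ] ℂ) (mfderiv (projCotangentModel E') 𝓘(ℂ, E')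
      (fun z : ProjCotangent E' Y => z.1) (Φ z₀)
        (mfderiv (projCotangentModel E) (projCotangentModel E') Φ z₀ v)) =
      liouvilleForm (χ (s z₀)) (mfderiv (projCotangentModel E) (cotangentModel E')
        (χ ∘ s) z₀ v) := by
    refine Eq.trans ?_ h2.symm
    exact congrArg (fun A : E × ProjModel (E →L[ℂ] ℂ) →L[ℂ] E' =>
      ((χ (s z₀)).1.2 : E' →L[ℂ] ℂ) (A v)) d2.symm
  have h6 : liouvilleForm (χ (s z₀)) (mfderiv (projCotangentModel E) (cotangentModel E')
        (χ ∘ s) z₀ v) = liouvilleForm (s z₀) (mfderiv (projCotangentModel E) (cotangentModel E)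
        s z₀ v) := by
    rw [← h3]
    exact congrArg (liouvilleForm (χ (s z₀))) h4
  rw [h5, h6, h1]
  exact Eq.congr_left (congrArg (fun A : E × ProjModel (E →L[ℂ] ℂ) →L[ℂ] E =>
      ((s z₀).1.2 : E →L[ℂ] ℂ) (A v)) d1.symm)

end InducedMap

/-! ### The differential of the projection to projective space. -/

section ProjDeriv

variable {V : Type*} [NormedAddCommGroup V] [NormedSpace ℂ V] [FiniteDimensional ℂ V]

/-- The differential at `x` of the projection `V ∖ {0} → ℙ V`, in the preferred chart at `p = [x]`. -/
def projDeriv (p : ℙ ℂ V) (x : V) : V →L[ℂ] ProjModel V :=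
  (preferredCoord p x).1⁻¹ • (ContinuousLinearMap.snd ℂ ℂ (ProjModel V) ∘L
      (preferredCoord p : V →L[ℂ] ℂ × ProjModel V)) -
    ((preferredCoord p x).1⁻¹ ^ 2 • (ContinuousLinearMap.fst ℂ ℂ (ProjModel V) ∘L
      (preferredCoord p : V →L[ℂ] ℂ × ProjModel V))).smulRight (preferredCoord p x).2

theorem projDeriv_apply (p : ℙ ℂ V) (x v : V) :
    projDeriv p x v = (preferredCoord p x).1⁻¹ • (preferredCoord p v).2 -
      ((preferredCoord p x).1⁻¹ ^ 2 * (preferredCoord p v).1) • (preferredCoord p x).2 := rfl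

theorem projDeriv_self (p : ℙ ℂ V) (x : V) : projDeriv p x x = 0 := by
  rw [projDeriv_apply, sub_eq_zero]
  congr 1
  by_cases h : (preferredCoord p x).1 = 0
  · simp [h]
  · field_simp

/-- Affine coordinates are homogeneous of degree `0`, so their differential is homogeneous of degree
`-1`. This is the source of the factor `c⁻¹` on covectors. With `0⁻¹ = 0` the formula persists for
`c = 0`. -/
theorem projDeriv_smul (p : ℙ ℂ V) (c : ℂ) (x : V) :
    projDeriv p (c • x) = c⁻¹ • projDeriv p x := by
  ext1 v
  by_cases hc : c = 0
  · simp [hc, projDeriv_apply]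
  · simp only [projDeriv_apply, map_smul, Prod.smul_fst, Prod.smul_snd, smul_apply, smul_sub,
      smul_smul, smul_eq_mul, mul_inv]
    congr 2
    field_simp

theorem hasFDerivAt_affine (p : ℙ ℂ V) {x : V} (hx : (preferredCoord p x).1 ≠ 0) :
    HasFDerivAt (fun v => (preferredCoord p v).1⁻¹ • (preferredCoord p v).2) (projDeriv p x) x := by
  have h := (preferredCoord p).hasFDerivAt (x := x)
  have h1 : HasFDerivAt (fun v => (preferredCoord p v).1) _ x := h.fst
  have h2 : HasFDerivAt (fun v => (preferredCoord p v).2) _ x := h.snd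
  refine (((hasDerivAt_inv hx).comp_hasFDerivAt x h1).smul h2).congr_fderiv ?_
  ext1 v
  simp [projDeriv_apply, sub_eq_add_neg]

/-- A right inverse of `projDeriv p x`. -/
def projDerivSection (p : ℙ ℂ V) (x : V) : ProjModel V →L[ℂ] V :=
  (preferredCoord p x).1 • ((preferredCoord p).symm : ℂ × ProjModel V →L[ℂ] V) ∘L
    ContinuousLinearMap.inr ℂ ℂ (ProjModel V)

theorem projDerivSection_apply (p : ℙ ℂ V) (x : V) (y : ProjModel V) :
    projDerivSection p x y = (preferredCoord p x).1 • (preferredCoord p).symm (0, y) := rfl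

theorem projDeriv_section {p : ℙ ℂ V} {x : V} (hx : (preferredCoord p x).1 ≠ 0) (y : ProjModel V) :
    projDeriv p x (projDerivSection p x y) = y := by
  simp [projDeriv_apply, projDerivSection_apply, smul_smul, hx]

/-- Shows that the kernel of the differential at `x` is the line `ℂ x`, and hence that every form
vanishing on `x` factors through the differential. -/
theorem projDerivSection_projDeriv {p : ℙ ℂ V} {x : V} (hx : (preferredCoord p x).1 ≠ 0) (v : V) :
    projDerivSection p x (projDeriv p x v) =
      v - ((preferredCoord p x).1⁻¹ * (preferredCoord p v).1) • x := by
  apply (preferredCoord p).injective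
  ext1
  · simp [projDerivSection_apply]
    field_simp
    simp
  · simp [projDeriv_apply, projDerivSection_apply, smul_smul, smul_sub, hx]
    congr 1
    field_simp

variable {EM HM M : Type*} [NormedAddCommGroup EM]
    [NormedSpace ℂ EM] [TopologicalSpace HM] {IM : ModelWithCorners ℂ EM HM} [TopologicalSpace M]
    [ChartedSpace HM M]

/-- The tangent space at `g m` is identified with the model space through the preferred chart there,
whose differential at that point is therefore the identity. -/
theorem mfderiv_extChartAt_comp {E H N : Type*} [NormedAddCommGroup E]
    [NormedSpace ℂ E] [TopologicalSpace H] {I : ModelWithCorners ℂ E H} [TopologicalSpace N]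
    [ChartedSpace H N] [IsManifold I 1 N] {g : M → N} {m : M} (hg : MDifferentiableAt IM I g m) :
    mfderiv IM 𝓘(ℂ, E) (extChartAt I (g m) ∘ g) m = mfderiv IM I g m := by
  rw [mfderiv_comp m (mdifferentiableAt_extChartAt (mem_chart_source H (g m))) hg,
    mfderiv_extChartAt_self]
  rfl

/-- The differential of a map into projective space which lifts to `V ∖ {0}`. -/
theorem mfderiv_proj_of_lift {g : M → ℙ ℂ V} {G : M → V} {m : M}
    (hgd : MDifferentiableAt IM 𝓘(ℂ, ProjModel V) g m)
    (hG : MDifferentiableAt IM 𝓘(ℂ, V) G m)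
    (hg : ∀ᶠ x in 𝓝 m, ∃ h : G x ≠ 0, g x = Projectivization.mk ℂ (G x) h) (v : TangentSpace IM m) :
    mfderiv IM 𝓘(ℂ, ProjModel V) g m v =
      projDeriv (g m) (G m) (mfderiv IM 𝓘(ℂ, V) G m v) := by
  obtain ⟨h0, hgm⟩ := hg.self_of_nhds
  have he : (preferredCoord (g m) (G m)).1 ≠ 0 := by
    have := preferredCoord_ne_zero h0
    rwa [← hgm] at this
  have hk := (hasFDerivAt_affine (g m) he).hasMFDerivAt
  have h1 := (hk.comp m hG.hasMFDerivAt).mfderiv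
  have h2 : extChartAt 𝓘(ℂ, ProjModel V) (g m) ∘ g =ᶠ[𝓝 m]
    (fun v => (preferredCoord (g m) v).1⁻¹ • (preferredCoord (g m) v).2) ∘ G := by
    filter_upwards [hg] with x ⟨hx, hgx⟩
    rw [Function.comp, extChartAt_proj_apply, hgx]
    rfl
  have h3 := mfderiv_extChartAt_comp hgd
  rw [← h3, h2.mfderiv_eq, h1]
  rfl

theorem mfderiv_subtype_val_opens {E : Type*} [NormedAddCommGroup E]
    [NormedSpace ℂ E] {U : TopologicalSpace.Opens E} (x : U) (v : E) :
    (mfderiv 𝓘(ℂ, E) 𝓘(ℂ, E) (Subtype.val : U → E) x : E →L[ℂ] E) v = v := by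
  have hd := (contMDiff_subtype_val (I := 𝓘(ℂ, E)) (n := ω) x).mdifferentiableAt (by simp)
  rw [hd.mfderiv, ModelWithCorners.range_eq_univ, fderivWithin_univ]
  have h : writtenInExtChartAt 𝓘(ℂ, E) 𝓘(ℂ, E) x (Subtype.val : U → E)
      =ᶠ[𝓝 (extChartAt 𝓘(ℂ, E) x x)] id :=
    (U.chartAt_subtype_val_symm_eventuallyEq (H := E) (x := x)).symm
  rw [h.fderiv_eq, fderiv_id]
  rfl

theorem mfderiv_projMap (x : Punctured V) (v : V) :
    (mfderiv 𝓘(ℂ, V) 𝓘(ℂ, ProjModel V) projMap x : V →L[ℂ] ProjModel V) v =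
      projDeriv (projMap x) x v := by
  have := mfderiv_proj_of_lift (G := fun x : Punctured V => (x : V))
    ((contMDiff_projMap x).mdifferentiableAt (by simp))
    ((contMDiff_subtype_val (n := ω) x).mdifferentiableAt (by simp))
    (Filter.Eventually.of_forall fun x => ⟨x.2, rfl⟩) (show TangentSpace 𝓘(ℂ, V) x from v)
  refine this.trans ?_
  congr 1
  exact mfderiv_subtype_val_opens x v
end ProjDeriv

/-! ### Covectors of projective space as pairs of a vector and a form. -/

section CoLift

variable {V : Type*} [NormedAddCommGroup V] [NormedSpace ℂ V] [FiniteDimensional ℂ V]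

/-- The punctured cotangent bundle of the projective space of `V`. -/
abbrev ProjT (V : Type*) [NormedAddCommGroup V] [NormedSpace ℂ V] [FiniteDimensional ℂ V] :=
  PuncturedCotangent (ProjModel V) (ℙ ℂ V)

/-- The covector `z`, as a linear form on the model space. -/
def covectorForm (z : ProjT V) : ProjModel V →L[ℂ] ℂ := z.1.2

/-- The pull-back to `x` of the covector `z` at `[x]`. -/
def coLift (z : ProjT V) (x : V) : V →L[ℂ] ℂ :=
  covectorForm z ∘L projDeriv z.1.1 x

theorem coLift_apply (z : ProjT V) (x v : V) :
    coLift z x v = covectorForm z (projDeriv z.1.1 x v) := rfl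

theorem coLift_self (z : ProjT V) (x : V) : coLift z x x = 0 := by
  rw [coLift_apply, projDeriv_self, map_zero]

theorem coLift_smul_right (z : ProjT V) (c : ℂ) (x : V) :
    coLift z (c • x) = c⁻¹ • coLift z x := by
  ext v
  simp [coLift_apply, projDeriv_smul]

theorem coLift_smul_left (c : ℂˣ) (z : ProjT V) (x : V) :
    coLift (c • z) x = (c : ℂ) • coLift z x := rfl

/-- `(x, ξ)` is a lift of the covector `z` of projective space: `z` is based at `[x]` and its
pull-back to `x` is `ξ`. -/
structure IsCoLift (z : ProjT V) (x : V) (ξ : V →L[ℂ] ℂ) : Prop where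
  ne_zero : x ≠ 0
  mk_eq : z.1.1 = Projectivization.mk ℂ x ne_zero
  coLift_eq : coLift z x = ξ

namespace IsCoLift

variable {z z' : ProjT V} {x : V} {ξ : V →L[ℂ] ℂ}

theorem coord_ne_zero (h : IsCoLift z x ξ) : (preferredCoord z.1.1 x).1 ≠ 0 := by
  rw [h.mk_eq]; exact preferredCoord_ne_zero h.ne_zero

/-- The differential of the projection has a right inverse, so a covector is recovered from its
pull-back; uniqueness and non-vanishing of lifts follow. -/
theorem eq_comp_section (h : IsCoLift z x ξ) (y : ProjModel V) :
    covectorForm z y = ξ (projDerivSection z.1.1 x y) := by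
  rw [← h.coLift_eq, coLift_apply, projDeriv_section h.coord_ne_zero]

theorem dual_ne_zero (h : IsCoLift z x ξ) : ξ ≠ 0 := by
  rintro rfl
  exact z.2 (ContinuousLinearMap.ext fun y => h.eq_comp_section y)

theorem apply_self (h : IsCoLift z x ξ) : ξ x = 0 := by
  rw [← h.coLift_eq, coLift_self]

/-- Together with `exists_unit`, this identifies the lifts of a covector with one orbit of `(x, ξ) ↦
(c x, c⁻¹ ξ)`. -/
theorem smul (h : IsCoLift z x ξ) (c : ℂˣ) : IsCoLift z ((c : ℂ) • x) ((c : ℂ)⁻¹ • ξ) where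
  ne_zero := smul_ne_zero c.ne_zero h.ne_zero
  mk_eq := by
    rw [h.mk_eq]
    exact (Projectivization.mk_eq_mk_iff ℂ _ _ _ _).2 ⟨c⁻¹, by simp [Units.smul_def]⟩
  coLift_eq := by rw [coLift_smul_right, h.coLift_eq]

theorem smul_left (h : IsCoLift z x ξ) (c : ℂˣ) : IsCoLift (c • z) x ((c : ℂ) • ξ) where
  ne_zero := h.ne_zero
  mk_eq := h.mk_eq
  coLift_eq := by rw [coLift_smul_left, h.coLift_eq]

theorem unique (h : IsCoLift z x ξ) (h' : IsCoLift z' x ξ) : z = z' := by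
  have hz : z.1.1 = z'.1.1 := h.mk_eq.trans h'.mk_eq.symm
  refine puncturedCotangent_ext hz fun v => ?_
  change covectorForm z v = covectorForm z' v
  rw [h.eq_comp_section, h'.eq_comp_section, hz]

theorem exists_unit {x' : V} {ξ' : V →L[ℂ] ℂ} (h : IsCoLift z x ξ) (h' : IsCoLift z x' ξ') :
    ∃ c : ℂˣ, x' = (c : ℂ) • x ∧ ξ' = (c : ℂ)⁻¹ • ξ := by
  have := h'.mk_eq.symm.trans h.mk_eq
  obtain ⟨c, rfl⟩ := (Projectivization.mk_eq_mk_iff ℂ _ _ _ _).1 this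
  exact ⟨c, rfl, h'.coLift_eq.symm.trans (h.smul c).coLift_eq⟩

theorem rep (z : ProjT V) : IsCoLift z z.1.1.rep (coLift z z.1.1.rep) where
  ne_zero := z.1.1.rep_nonzero
  mk_eq := z.1.1.mk_rep.symm
  coLift_eq := rfl

end IsCoLift

/-- The covector of projective space with a given lift. -/
def ofLift (x : V) (ξ : V →L[ℂ] ℂ) (hx : x ≠ 0) (hξ : ξ ≠ 0) (h : ξ x = 0) : ProjT V :=
  PuncturedCotangent.mk (E := ProjModel V) (Projectivization.mk ℂ x hx)
    (ξ ∘L projDerivSection (Projectivization.mk ℂ x hx) x) (by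
      intro h0
      apply hξ
      ext v
      have h1 : ξ (projDerivSection (Projectivization.mk ℂ x hx) x
          (projDeriv (Projectivization.mk ℂ x hx) x v)) = 0 :=
        congrArg (fun A : ProjModel V →L[ℂ] ℂ =>
          A (projDeriv (Projectivization.mk ℂ x hx) x v)) h0
      -- The section changes `v` only by a multiple of `x`, on which `ξ` vanishes.
      rw [projDerivSection_projDeriv (preferredCoord_ne_zero hx)] at h1
      simpa [h] using h1)

theorem isCoLift_ofLift {x : V} {ξ : V →L[ℂ] ℂ} (hx : x ≠ 0) (hξ : ξ ≠ 0) (h : ξ x = 0) :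
    IsCoLift (ofLift x ξ hx hξ h) x ξ where
  ne_zero := hx
  mk_eq := rfl
  coLift_eq := by
    ext v
    change ξ (projDerivSection (Projectivization.mk ℂ x hx) x
      (projDeriv (Projectivization.mk ℂ x hx) x v)) = _
    rw [projDerivSection_projDeriv (preferredCoord_ne_zero hx)]
    simp [h]

theorem isCoLift_mk (x : Punctured V) {ξ : V →L[ℂ] ℂ}
    {p : TangentSpace 𝓘(ℂ, ProjModel V) (projMap x) →L[ℂ] ℂ} (hp : p ≠ 0)
    (h : PullsBackTo x p ξ) : IsCoLift (PuncturedCotangent.mk (projMap x) p hp) x ξ where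
  ne_zero := x.2
  mk_eq := rfl
  coLift_eq := by
    rw [← h]
    ext v
    exact congrArg (p : ProjModel V →L[ℂ] ℂ) (mfderiv_projMap x v).symm

theorem pullsBackTo_of_isCoLift (x : Punctured V) {ξ : V →L[ℂ] ℂ}
    {p : TangentSpace 𝓘(ℂ, ProjModel V) (projMap x) →L[ℂ] ℂ} (hp : p ≠ 0)
    (h : IsCoLift (PuncturedCotangent.mk (projMap x) p hp) x ξ) : PullsBackTo x p ξ := by
  rw [← h.coLift_eq]
  ext v
  exact congrArg (p : ProjModel V →L[ℂ] ℂ) (mfderiv_projMap x v)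

variable {EM HM M : Type*} [NormedAddCommGroup EM]
    [NormedSpace ℂ EM] [TopologicalSpace HM] {IM : ModelWithCorners ℂ EM HM} [TopologicalSpace M]
    [ChartedSpace HM M]

/-- The inverse chart lifts to the affine map `y ↦ e⁻¹ (1, y)`, whose derivative is `v ↦ e⁻¹ (0,
v)`. -/
theorem mfderiv_extChartAt_symm_proj (b : ℙ ℂ V) (y v : ProjModel V) :
    (mfderiv 𝓘(ℂ, ProjModel V) 𝓘(ℂ, ProjModel V) (extChartAt 𝓘(ℂ, ProjModel V) b).symm y :
      ProjModel V →L[ℂ] ProjModel V) v =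
    projDeriv ((affineChart (preferredCoord b)).symm y) ((preferredCoord b).symm (1, y))
      ((preferredCoord b).symm (0, v)) := by
  set e := preferredCoord b
  have hG : HasFDerivAt (fun y : ProjModel V => e.symm (1, y))
      ((e.symm : ℂ × ProjModel V →L[ℂ] V) ∘L ContinuousLinearMap.inr ℂ ℂ (ProjModel V)) y :=
    e.symm.hasFDerivAt.comp y ((hasFDerivAt_const (1 : ℂ) y).prodMk (hasFDerivAt_id y))
  have hd : MDifferentiableAt 𝓘(ℂ, ProjModel V) 𝓘(ℂ, ProjModel V)
      (extChartAt 𝓘(ℂ, ProjModel V) b).symm y :=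
    (contMDiffAt_symm_of_mem_maximalAtlas (n := ω) (I := 𝓘(ℂ, ProjModel V)) (e := affineChart e)
      (IsManifold.subset_maximalAtlas (mem_range_self e)) (mem_univ y)).mdifferentiableAt (by simp)
  have := mfderiv_proj_of_lift hd hG.hasMFDerivAt.mdifferentiableAt
    (Filter.Eventually.of_forall fun y => ⟨by simp, rfl⟩) v
  rw [hG.hasMFDerivAt.mfderiv] at this
  exact this

/-- The inverse chart lifts through the normalized vector `x / x₀`, where `x₀` is the leading
coordinate of `x`. The pull-back to that vector is `x₀ ξ`, and the chart directions are those with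
leading coordinate `0`. -/
theorem IsCoLift.covectorCoord_eq {z : ProjT V} {x : V} {ξ : V →L[ℂ] ℂ} (h : IsCoLift z x ξ)
    {b : ℙ ℂ V} (hb : z.1.1 ∈ (chartAt (ProjModel V) b).source) :
    covectorCoord b z.1.1 z.1.2 = (preferredCoord b x).1 • ξ ∘L
      (((preferredCoord b).symm : ℂ × ProjModel V →L[ℂ] V) ∘L
        ContinuousLinearMap.inr ℂ ℂ (ProjModel V)) := by
  have hb' := hb
  rw [h.mk_eq] at hb'
  have hx : (preferredCoord b x).1 ≠ 0 := hb'
  ext v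
  refine (congrArg (covectorForm z) (mfderiv_extChartAt_symm_proj b _ v)).trans ?_
  have h1 : (preferredCoord b).symm (1, extChartAt 𝓘(ℂ, ProjModel V) b z.1.1) =
      (preferredCoord b x).1⁻¹ • x := by
    apply (preferredCoord b).injective
    rw [h.mk_eq, extChartAt_proj_apply]
    ext1 <;> simp [hx]
  have h2 : (affineChart (preferredCoord b)).symm (extChartAt 𝓘(ℂ, ProjModel V) b z.1.1) = z.1.1 :=
    (affineChart (preferredCoord b)).left_inv hb
  rw [h1, h2, projDeriv_smul, inv_inv]
  rw [← h.coLift_eq]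
  simp [coLift_apply]

/-- A map into the punctured cotangent bundle of projective space is analytic if it has
analytic lifts. -/
theorem contMDiffAt_of_isCoLift {f : M → ProjT V} {G : M → V} {Ξ : M → V →L[ℂ] ℂ} {m : M}
    (hG : ContMDiffAt IM 𝓘(ℂ, V) ω G m) (hΞ : ContMDiffAt IM 𝓘(ℂ, V →L[ℂ] ℂ) ω Ξ m)
    (h : ∀ᶠ y in 𝓝 m, IsCoLift (f y) (G y) (Ξ y)) :
    ContMDiffAt IM (cotangentModel (ProjModel V)) ω f m := by
  have h1 : ContMDiffAt IM 𝓘(ℂ, ProjModel V) ω (fun y => (f y).1.1) m :=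
    contMDiffAt_proj_of_lift hG (h.mono fun y hy => ⟨hy.ne_zero, hy.mk_eq⟩)
  refine contMDiffAt_puncturedCotangent_iff.2 ⟨h1, ?_⟩
  set e := preferredCoord (f m).1.1
  have heG : ContMDiffAt IM 𝓘(ℂ, ℂ) ω (fun y => (e (G y)).1) m := by
    have : ContDiff ℂ ω (fun v => (e v).1) := by fun_prop
    exact this.contMDiff.contMDiffAt.comp m hG
  have h2 : ContMDiffAt IM 𝓘(ℂ, ProjModel V →L[ℂ] ℂ) ω (fun y => (e (G y)).1 • (Ξ y) ∘L
      ((e.symm : ℂ × ProjModel V →L[ℂ] V) ∘L ContinuousLinearMap.inr ℂ ℂ (ProjModel V))) m := by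
    refine heG.smul ?_
    exact hΞ.clm_comp contMDiffAt_const
  refine h2.congr_of_eventuallyEq ?_
  filter_upwards [h, h1.continuousAt.preimage_mem_nhds
    ((chartAt (ProjModel V) (f m).1.1).open_source.mem_nhds (mem_chart_source _ _))] with y hy hb
  exact hy.covectorCoord_eq hb

/-- The punctured cotangent bundle of projective space has local analytic lifts. -/
theorem exists_isCoLift (z₀ : ProjT V) : ∃ (G : ProjT V → V) (Ξ : ProjT V → V →L[ℂ] ℂ),
    ContMDiffAt (cotangentModel (ProjModel V)) 𝓘(ℂ, V) ω G z₀ ∧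
    ContMDiffAt (cotangentModel (ProjModel V)) 𝓘(ℂ, V →L[ℂ] ℂ) ω Ξ z₀ ∧
    ∀ᶠ z in 𝓝 z₀, IsCoLift z (G z) (Ξ z) := by
  set b := z₀.1.1
  set e := preferredCoord b
  have hb : b ∈ (affineChart e).source := mem_chart_source (ProjModel V) b
  have h1 := contMDiff_puncturedCotangent_proj z₀
  have hy : ContMDiffAt (cotangentModel (ProjModel V)) 𝓘(ℂ, ProjModel V) ω
      (fun z : ProjT V => affineChart e z.1.1) z₀ :=
    ContMDiffAt.comp z₀ (contMDiffAt_affineChart e hb) h1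
  -- At the normalized vector with coordinates `(1, y)` the differential of `v'/v₀` is `v ↦ v' - v₀
  -- y`; composing the fiber coordinate with it gives the pull-back.
  refine ⟨fun z => affineSection e z.1.1, fun z => covectorCoord b z.1.1 z.1.2 ∘L
    (ContinuousLinearMap.snd ℂ ℂ (ProjModel V) -
      (ContinuousLinearMap.fst ℂ ℂ (ProjModel V)).smulRight (affineChart e z.1.1)) ∘L
    (e : V →L[ℂ] ℂ × ProjModel V), ?_, ?_, ?_⟩
  · exact ContMDiffAt.comp (g := affineSection e) z₀ (contMDiffAt_affineSection e hb) h1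
  · refine (contMDiffAt_covectorCoord z₀).clm_comp (ContMDiffAt.clm_comp ?_ contMDiffAt_const)
    refine contMDiffAt_const.sub ?_
    have : ContDiff ℂ ω (fun y : ProjModel V =>
      (ContinuousLinearMap.fst ℂ ℂ (ProjModel V)).smulRight y) :=
        (ContinuousLinearMap.smulRightL ℂ (ℂ × ProjModel V) (ProjModel V)
          (ContinuousLinearMap.fst ℂ ℂ (ProjModel V))).contDiff
    exact this.contMDiff.contMDiffAt.comp z₀ hy
  · filter_upwards [h1.continuousAt.preimage_mem_nhds
      ((affineChart e).open_source.mem_nhds hb)] with z hz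
    have hl : IsCoLift z (affineSection e z.1.1) (coLift z (affineSection e z.1.1)) :=
      ⟨affineSection_ne_zero _ _, (mk_affineSection hz).symm, rfl⟩
    refine ⟨hl.ne_zero, hl.mk_eq, ?_⟩
    rw [hl.covectorCoord_eq hz]
    ext v
    have hv : e.symm (0, (e v).2 - (e v).1 • affineChart e z.1.1) =
        v - (e v).1 • affineSection e z.1.1 := by
      apply e.injective
      ext1 <;> simp [affineSection]
    have h1 : (e (affineSection e z.1.1)).1 = 1 := by simp [affineSection]
    change _ = (e (affineSection e z.1.1)).1 • coLift z (affineSection e z.1.1)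
      (e.symm (0, (e v).2 - (e v).1 • affineChart e z.1.1))
    rw [h1, hv, one_smul, map_sub, map_smul, coLift_self]
    simp

/-- The Liouville form in terms of lifts: `α = ⟨ξ, dx⟩`. -/
theorem liouvilleForm_of_isCoLift {f : M → ProjT V} {G : M → V} {Ξ : M → V →L[ℂ] ℂ} {m : M}
    (hf : MDifferentiableAt IM (cotangentModel (ProjModel V)) f m)
    (hG : MDifferentiableAt IM 𝓘(ℂ, V) G m)
    (h : ∀ᶠ y in 𝓝 m, IsCoLift (f y) (G y) (Ξ y)) (v : TangentSpace IM m) :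
    liouvilleForm (f m) (mfderiv IM (cotangentModel (ProjModel V)) f m v) =
      Ξ m (mfderiv IM 𝓘(ℂ, V) G m v) := by
  rw [liouvilleForm_mfderiv hf]
  have hfd : MDifferentiableAt IM 𝓘(ℂ, ProjModel V) (fun y => (f y).1.1) m :=
    ((contMDiff_puncturedCotangent_proj (f m)).mdifferentiableAt (by simp)).comp m hf
  rw [mfderiv_proj_of_lift hfd hG (h.mono fun y hy => ⟨hy.ne_zero, hy.mk_eq⟩) v]
  exact congrArg (fun A : V →L[ℂ] ℂ => A (mfderiv IM 𝓘(ℂ, V) G m v)) h.self_of_nhds.coLift_eq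

end CoLift

theorem DifferentiableAt.continuousAlternatingMap_ofSubsingleton {E F G : Type*}
    [NormedAddCommGroup E] [NormedSpace ℂ E] [NormedAddCommGroup F] [NormedSpace ℂ F]
    [NormedAddCommGroup G] [NormedSpace ℂ G] {A : F → E →L[ℂ] G} {y : F}
    (hA : DifferentiableAt ℂ A y) :
    DifferentiableAt ℂ
      (fun y => ContinuousAlternatingMap.ofSubsingleton ℂ E G (0 : Fin 1) (A y)) y :=
  (ContinuousAlternatingMap.ofSubsingletonLIE (𝕜 := ℂ) (E := E) (F := G)
    (i := (0 : Fin 1))).differentiable.differentiableAt.comp y hA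

/-! ### The homogeneous symplectic isomorphism exchanging vectors and forms. -/

section Legendre

variable {V : Type*} [NormedAddCommGroup V] [NormedSpace ℂ V] [FiniteDimensional ℂ V]
  {W : Type*} [NormedAddCommGroup W] [NormedSpace ℂ W] [FiniteDimensional ℂ W]

/-- In the chart, `α` is `⟨Ξ, dG⟩` for local analytic lifts `G` and `Ξ`. This supplies the
differentiability needed to pull back the exterior derivative. -/
theorem differentiableAt_liouvilleForm (z₀ : ProjT V) :
    DifferentiableAt ℂ (oneFormInChart (I := cotangentModel (ProjModel V)) (M := ProjT V)
      liouvilleForm z₀) (extChartAt (cotangentModel (ProjModel V)) z₀ z₀) := by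
  set I := cotangentModel (ProjModel V)
  set c := (extChartAt I z₀).symm
  set y₀ := extChartAt I z₀ z₀
  obtain ⟨G, Ξ, hG, hΞ, h⟩ := exists_isCoLift z₀
  have hcy : c y₀ = z₀ := extChartAt_to_inv z₀
  have hc : ∀ y ∈ (extChartAt I z₀).target,
      ContMDiffAt 𝓘(ℂ, ProjModel V × (ProjModel V →L[ℂ] ℂ)) I ω c y := fun y hy =>
    (contMDiffOn_extChartAt_symm z₀).contMDiffAt ((isOpen_extChartAt_target z₀).mem_nhds hy)
  have hc₀ := hc y₀ (mem_extChartAt_target z₀)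
  have hGc : ContDiffAt ℂ ω (G ∘ c) y₀ :=
    (ContMDiffAt.comp y₀ (by rwa [hcy]) hc₀).contDiffAt
  have hΞc : ContDiffAt ℂ ω (Ξ ∘ c) y₀ :=
    (ContMDiffAt.comp y₀ (by rwa [hcy]) hc₀).contDiffAt
  have hl : ∀ᶠ y in 𝓝 y₀, IsCoLift (c y) (G (c y)) (Ξ (c y)) :=
    hc₀.continuousAt.eventually (by rwa [hcy])
  have hD : DifferentiableAt ℂ (fun y => (Ξ ∘ c) y ∘L fderiv ℂ (G ∘ c) y) y₀ :=
    (hΞc.differentiableAt (by simp)).clm_comp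
      ((hGc.fderiv_right (m := 1) (by exact le_top)).differentiableAt (by simp))
  have hS : DifferentiableAt ℂ (fun y => ContinuousAlternatingMap.ofSubsingleton ℂ
      (ProjModel V × (ProjModel V →L[ℂ] ℂ)) ℂ (0 : Fin 1)
        ((Ξ ∘ c) y ∘L fderiv ℂ (G ∘ c) y)) y₀ :=
    hD.continuousAlternatingMap_ofSubsingleton
  refine hS.congr_of_eventuallyEq ?_
  filter_upwards [hl.eventually_nhds, hGc.eventually (by simp),
    extChartAt_target_mem_nhds (I := I) z₀] with y hy hGy hyt
  rw [oneFormInChart]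
  congr 1
  refine ContinuousLinearMap.ext fun v => ?_
  have := liouvilleForm_of_isCoLift ((hc y hyt).mdifferentiableAt (by simp))
    (hGy.differentiableAt (by simp)).mdifferentiableAt hy v
  rw [mfderiv_eq_fderiv] at this
  exact this

omit [FiniteDimensional ℂ V] in
/-- The derivative of a vanishing pairing. -/
theorem pairing_mfderiv_of_eq_zero {EM HM M : Type*} [NormedAddCommGroup EM]
    [NormedSpace ℂ EM] [TopologicalSpace HM] {IM : ModelWithCorners ℂ EM HM} [TopologicalSpace M]
    [ChartedSpace HM M] {Ξ : M → V →L[ℂ] ℂ} {G : M → V} {m : M}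
    (hΞ : MDifferentiableAt IM 𝓘(ℂ, V →L[ℂ] ℂ) Ξ m) (hG : MDifferentiableAt IM 𝓘(ℂ, V) G m)
    (h : ∀ᶠ y in 𝓝 m, Ξ y (G y) = 0) (v : TangentSpace IM m) :
    Ξ m (mfderiv IM 𝓘(ℂ, V) G m v) +
      (show V →L[ℂ] ℂ from mfderiv IM 𝓘(ℂ, V →L[ℂ] ℂ) Ξ m v) (G m) = 0 := by
  have h1 := (show HasMFDerivAt IM 𝓘(ℂ, (V →L[ℂ] ℂ) × V) (fun y => (Ξ y, G y)) m
    (ContinuousLinearMap.prod (show EM →L[ℂ] (V →L[ℂ] ℂ) from mfderiv IM 𝓘(ℂ, V →L[ℂ] ℂ) Ξ m)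
      (show EM →L[ℂ] V from mfderiv IM 𝓘(ℂ, V) G m)) from
    ⟨hΞ.hasMFDerivAt.1.prodMk hG.hasMFDerivAt.1, hΞ.hasMFDerivAt.2.prodMk hG.hasMFDerivAt.2⟩)
  have h2 := ((isBoundedBilinearMap_apply (𝕜 := ℂ) (E := V) (F := ℂ)).hasFDerivAt
    (Ξ m, G m)).hasMFDerivAt
  have h3 := HasMFDerivAt.comp m h2 h1
  have h4 : (fun p : (V →L[ℂ] ℂ) × V => p.1 p.2) ∘ (fun y => (Ξ y, G y)) =ᶠ[𝓝 m]
    fun _ => 0 := h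
  have h5 := h4.mfderiv_eq (I := IM) (I' := 𝓘(ℂ, ℂ))
  rw [h3.mfderiv, mfderiv_const] at h5
  exact congrArg (fun A : EM →L[ℂ] ℂ => A v) h5

variable (D : (V →L[ℂ] ℂ) ≃L[ℂ] W) (D' : (W →L[ℂ] ℂ) ≃L[ℂ] V)

/-- The isomorphisms `V* ≃ W` and `W* ≃ V` define opposite pairings of `V` and `W`. -/
def IsSkewDual : Prop := ∀ v w, D'.symm v w = -D.symm w v

variable {D D'}

-- By this symmetry the inverse of the induced map is an instance of the same construction, and
-- analyticity in one direction suffices.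
omit [FiniteDimensional ℂ V] [FiniteDimensional ℂ W] in
theorem IsSkewDual.symm (h : IsSkewDual D D') : IsSkewDual D' D := fun w v => by
  rw [h v w, neg_neg]

omit [FiniteDimensional ℂ V] [FiniteDimensional ℂ W] in
theorem IsSkewDual.apply_eq_zero (h : IsSkewDual D D') {x : V} {ξ : V →L[ℂ] ℂ} (hx : ξ x = 0) :
    D'.symm x (D ξ) = 0 := by
  rw [h, D.symm_apply_apply, hx, neg_zero]

/-- The map of punctured cotangent bundles induced by `(x, ξ) ↦ (D ξ, D'⁻¹ x)`. -/
def dualMap (h : IsSkewDual D D') (z : ProjT V) : ProjT W :=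
  ofLift (D (coLift z z.1.1.rep)) (D'.symm z.1.1.rep)
    (by simpa using (IsCoLift.rep z).dual_ne_zero) (by simpa using z.1.1.rep_nonzero)
    (h.apply_eq_zero (coLift_self _ _))

/-- The definition uses a chosen representative; changing `(x, ξ)` to `(c x, c⁻¹ ξ)` changes `(D ξ,
D'⁻¹ x)` by the action of `c⁻¹`, so any lift gives the same covector. -/
theorem IsCoLift.dualMap (h : IsSkewDual D D') {z : ProjT V} {x : V} {ξ : V →L[ℂ] ℂ}
    (hz : IsCoLift z x ξ) : IsCoLift (dualMap h z) (D ξ) (D'.symm x) := by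
  obtain ⟨c, hx, hξ⟩ := (IsCoLift.rep z).exists_unit hz
  have := (isCoLift_ofLift (by simpa using (IsCoLift.rep z).dual_ne_zero)
    (by simpa using z.1.1.rep_nonzero)
    (h.apply_eq_zero (coLift_self z z.1.1.rep))).smul c⁻¹
  rw [hx, hξ, map_smul, map_smul]
  rw [Units.val_inv_eq_inv_val, inv_inv] at this
  exact this

theorem contMDiff_dualMap (h : IsSkewDual D D') :
    ContMDiff (cotangentModel (ProjModel V)) (cotangentModel (ProjModel W)) ω (dualMap h) := by
  intro z₀
  obtain ⟨G, Ξ, hG, hΞ, hl⟩ := exists_isCoLift z₀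
  exact contMDiffAt_of_isCoLift (D.contDiff.contMDiff.contMDiffAt.comp z₀ hΞ)
    (D'.symm.contDiff.contMDiff.contMDiffAt.comp z₀ hG) (hl.mono fun z hz => hz.dualMap h)

theorem dualMap_dualMap (h : IsSkewDual D D') (z : ProjT V) : dualMap h.symm (dualMap h z) = z := by
  have h1 := ((IsCoLift.rep z).dualMap h).dualMap h.symm
  rw [D'.apply_symm_apply, D.symm_apply_apply] at h1
  exact h1.unique (IsCoLift.rep z)

/-- The isomorphism of punctured cotangent bundles induced by `(x, ξ) ↦ (D ξ, D'⁻¹ x)`. -/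
def dualDiffeomorph (h : IsSkewDual D D') :
    Diffeomorph (cotangentModel (ProjModel V)) (cotangentModel (ProjModel W))
      (ProjT V) (ProjT W) ω where
  toFun := dualMap h
  invFun := dualMap h.symm
  left_inv := dualMap_dualMap h
  right_inv := dualMap_dualMap h.symm
  contMDiff_toFun := contMDiff_dualMap h
  contMDiff_invFun := contMDiff_dualMap h.symm

theorem dualMap_smul (h : IsSkewDual D D') (c : ℂˣ) (z : ProjT V) :
    dualMap h (c • z) = c • dualMap h z := by
  have h1 := ((IsCoLift.rep z).smul_left c).dualMap h
  -- The lift `(D ξ, c D'⁻¹ x)` of the scaled image is moved along its orbit to `(c D ξ, D'⁻¹ x)`,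
  -- the image of `(x, c ξ)`.
  have h2 := (((IsCoLift.rep z).dualMap h).smul_left c).smul c
  rw [map_smul] at h1
  rw [inv_smul_smul₀ c.ne_zero] at h2
  exact h1.unique h2

/-- On lifts, the form on the target pulls back to `(D'⁻¹ x)(D dξ) = -⟨dξ, x⟩` and the form on the
source is `⟨ξ, dx⟩`. Their difference is the differential of `⟨ξ, x⟩ = 0`; the opposite signs of the
pairings are essential here. -/
theorem liouvilleForm_dualMap (h : IsSkewDual D D') (z : ProjT V)
    (v : TangentSpace (cotangentModel (ProjModel V)) z) :
    liouvilleForm (dualMap h z) (mfderiv (cotangentModel (ProjModel V))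
      (cotangentModel (ProjModel W)) (dualMap h) z v) = liouvilleForm z v := by
  obtain ⟨G, Ξ, hG, hΞ, hl⟩ := exists_isCoLift z
  have hGd := hG.mdifferentiableAt (by simp)
  have hΞd := hΞ.mdifferentiableAt (by simp)
  have h1 := liouvilleForm_of_isCoLift
    ((contMDiff_dualMap h z).mdifferentiableAt (by simp))
    ((D.contDiff (n := ω)).contMDiff.contMDiffAt.comp z hΞ |>.mdifferentiableAt (by simp))
    (hl.mono fun z hz => hz.dualMap h) v
  have h2 := liouvilleForm_of_isCoLift (f := id) mdifferentiableAt_id hGd hl v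
  rw [mfderiv_id] at h2
  have h3 : mfderiv (cotangentModel (ProjModel V)) 𝓘(ℂ, W) (⇑D ∘ Ξ) z v =
      D (mfderiv (cotangentModel (ProjModel V)) 𝓘(ℂ, V →L[ℂ] ℂ) Ξ z v) :=
    congrArg (fun A : ProjModel V × (ProjModel V →L[ℂ] ℂ) →L[ℂ] W => A v)
      ((D.hasFDerivAt.hasMFDerivAt.comp z hΞd.hasMFDerivAt).mfderiv)
  have h4 := pairing_mfderiv_of_eq_zero hΞd hGd (hl.mono fun z hz => hz.apply_self) v
  refine h1.trans (Eq.trans ?_ h2.symm)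
  refine (congrArg (D'.symm (G z)) h3).trans ?_
  have key : ∀ (a : V →L[ℂ] ℂ) (w : V), Ξ z w + a (G z) = 0 →
      D'.symm (G z) (D a) = Ξ z w := fun a w haw => by
    rw [h, D.symm_apply_apply]
    exact (eq_neg_of_add_eq_zero_left haw).symm
  exact key _ _ h4

theorem isHomogeneousSymplectic_dualDiffeomorph (h : IsSkewDual D D') :
    IsHomogeneousSymplectic (dualDiffeomorph h) where
  map_smul := dualMap_smul h
  liouville := liouvilleForm_dualMap h
  symplectic z v w := extDerivOneForm_mfderiv (contMDiff_dualMap h) (liouvilleForm_dualMap h) z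
    (differentiableAt_liouvilleForm _) v w

end Legendre

/-! ### Homogeneous coordinates and contact hyperplanes of the incidence hypersurface. -/

section IncidenceMaps

variable {V : Type*} [NormedAddCommGroup V] [NormedSpace ℂ V] [FiniteDimensional ℂ V]

/-- Linear coordinates on `V` defining the preferred chart of the incidence hypersurface. -/
def incidenceCoord (s : incidence V) : V ≃L[ℂ] ℂ × MidCoord V × ℂ :=
  (exists_incidence_coordinates s.1.1.rep_nonzero s.1.2.rep_nonzero s.2).choose

/-- The normalized vector `x` of the point `([x], [ξ])` with coordinates `y`. -/
def incidencePoint (e : V ≃L[ℂ] ℂ × MidCoord V × ℂ) (y : IncidenceModel V) : V := e.symm (1, y.1)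

/-- The normalized form `ξ` of the point `([x], [ξ])` with coordinates `y`. -/
def incidenceForm (e : V ≃L[ℂ] ℂ × MidCoord V × ℂ) (y : IncidenceModel V) : V →L[ℂ] ℂ :=
  (dualCoord e).symm (1, y.2, -(y.2 y.1.1 + y.1.2))

omit [FiniteDimensional ℂ V] in
theorem incidencePoint_ne_zero (e : V ≃L[ℂ] ℂ × MidCoord V × ℂ) (y : IncidenceModel V) :
    incidencePoint e y ≠ 0 := by simp [incidencePoint]

theorem incidenceForm_ne_zero (e : V ≃L[ℂ] ℂ × MidCoord V × ℂ) (y : IncidenceModel V) :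
    incidenceForm e y ≠ 0 := by simp [incidenceForm]

theorem incidenceForm_apply (e : V ≃L[ℂ] ℂ × MidCoord V × ℂ) (y : IncidenceModel V) (v : V) :
    incidenceForm e y v = -(y.2 y.1.1 + y.1.2) * (e v).1 + y.2 (e v).2.1 + (e v).2.2 := by
  rw [dualCoord_pairing e, incidenceForm, ContinuousLinearEquiv.apply_symm_apply]
  simp

/-- `(x, ξ)` are homogeneous coordinates of the point `s` of the incidence hypersurface. -/
structure IsIncidenceLift (s : incidence V) (x : V) (ξ : V →L[ℂ] ℂ) : Prop where
  fst : ∃ h : x ≠ 0, s.1.1 = Projectivization.mk ℂ x h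
  snd : ∃ h : ξ ≠ 0, s.1.2 = Projectivization.mk ℂ ξ h

omit [FiniteDimensional ℂ V] in
theorem IsIncidenceLift.apply_eq_zero {s : incidence V} {x : V} {ξ : V →L[ℂ] ℂ}
    (h : IsIncidenceLift s x ξ) : ξ x = 0 := by
  obtain ⟨hx, hx'⟩ := h.fst
  obtain ⟨hξ, hξ'⟩ := h.snd
  have := s.2
  rwa [← Prod.mk.eta (p := s.1), hx', hξ', mem_incidence_mk] at this

theorem isIncidenceLift_chart {e : V ≃L[ℂ] ℂ × MidCoord V × ℂ} {s : incidence V}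
    (hs : s ∈ (incidenceChart e).source) :
    IsIncidenceLift s (incidencePoint e (incidenceChart e s))
      (incidenceForm e (incidenceChart e s)) := by
  have h := (incidenceChart e).left_inv hs
  exact ⟨⟨incidencePoint_ne_zero _ _, congrArg (fun s : incidence V => s.1.1) h.symm⟩,
    ⟨incidenceForm_ne_zero _ _, congrArg (fun s : incidence V => s.1.2) h.symm⟩⟩

omit [FiniteDimensional ℂ V] in
theorem hasFDerivAt_incidencePoint (e : V ≃L[ℂ] ℂ × MidCoord V × ℂ) (y : IncidenceModel V) :
    HasFDerivAt (incidencePoint e) ((e.symm : ℂ × MidCoord V × ℂ →L[ℂ] V) ∘L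
      (ContinuousLinearMap.prod 0 (ContinuousLinearMap.fst ℂ _ _))) y :=
  e.symm.hasFDerivAt.comp y ((hasFDerivAt_const (1 : ℂ) y).prodMk hasFDerivAt_fst)

omit [FiniteDimensional ℂ V] in
theorem contDiff_incidencePoint (e : V ≃L[ℂ] ℂ × MidCoord V × ℂ) :
    ContDiff ℂ ω (incidencePoint e) := by
  unfold incidencePoint; fun_prop

theorem contDiff_incidenceForm (e : V ≃L[ℂ] ℂ × MidCoord V × ℂ) :
    ContDiff ℂ ω (incidenceForm e) := by
  unfold incidenceForm; fun_prop

theorem fderiv_incidencePoint (e : V ≃L[ℂ] ℂ × MidCoord V × ℂ) (y v : IncidenceModel V) :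
    fderiv ℂ (incidencePoint e) y v = e.symm (0, v.1) := by
  rw [(hasFDerivAt_incidencePoint e y).fderiv]
  rfl

theorem fderiv_incidenceForm (e : V ≃L[ℂ] ℂ × MidCoord V × ℂ) (y v : IncidenceModel V) :
    fderiv ℂ (incidenceForm e) y v =
      (dualCoord e).symm (0, v.2, -(y.2 v.1.1 + v.2 y.1.1 + v.1.2)) := by
  have h1 : HasFDerivAt (fun y : IncidenceModel V => y.1.1) _ y :=
    (ContinuousLinearMap.fst ℂ (MidCoord V) ℂ ∘L ContinuousLinearMap.fst ℂ (MidCoord V × ℂ)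
      (MidCoord V →L[ℂ] ℂ)).hasFDerivAt
  have h2 : HasFDerivAt (fun y : IncidenceModel V => y.1.2) _ y :=
    (ContinuousLinearMap.snd ℂ (MidCoord V) ℂ ∘L ContinuousLinearMap.fst ℂ (MidCoord V × ℂ)
      (MidCoord V →L[ℂ] ℂ)).hasFDerivAt
  have h3 : HasFDerivAt (fun y : IncidenceModel V => y.2) _ y :=
    (ContinuousLinearMap.snd ℂ (MidCoord V × ℂ) (MidCoord V →L[ℂ] ℂ)).hasFDerivAt
  have h4 := (hasFDerivAt_const (1 : ℂ) y).prodMk (h3.prodMk ((h3.clm_apply h1).add h2).neg)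
  have h5 : HasFDerivAt (incidenceForm e) _ y := (dualCoord e).symm.hasFDerivAt.comp y h4
  rw [h5.fderiv]
  rfl

theorem contMDiffAt_extChartAt_comp {E H N F : Type*} [NormedAddCommGroup E]
    [NormedSpace ℂ E] [TopologicalSpace H] {I : ModelWithCorners ℂ E H} [TopologicalSpace N]
    [ChartedSpace H N] [IsManifold I ω N] [NormedAddCommGroup F] [NormedSpace ℂ F] {K : E → F}
    (hK : ContDiff ℂ ω K) (s : N) :
    ContMDiffAt I 𝓘(ℂ, F) ω (fun t => K (extChartAt I s t)) s :=
  hK.contMDiff.contMDiffAt.comp s contMDiffAt_extChartAt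

theorem mfderiv_comp_extChartAt {E H N F : Type*} [NormedAddCommGroup E]
    [NormedSpace ℂ E] [TopologicalSpace H] {I : ModelWithCorners ℂ E H} [TopologicalSpace N]
    [ChartedSpace H N] [IsManifold I ω N] [NormedAddCommGroup F] [NormedSpace ℂ F] {K : E → F}
    (hK : ContDiff ℂ ω K) (s : N) (v : E) :
    (mfderiv I 𝓘(ℂ, F) (fun t => K (extChartAt I s t)) s : E →L[ℂ] F) v =
      fderiv ℂ K (extChartAt I s s) v := by
  have : IsManifold I 1 N := IsManifold.of_le (n := ω) le_top
  have h1 : MDifferentiableAt I 𝓘(ℂ, E) (extChartAt I s) s :=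
    mdifferentiableAt_extChartAt (mem_chart_source H s)
  have h2 : MDifferentiableAt 𝓘(ℂ, E) 𝓘(ℂ, F) K (extChartAt I s s) :=
    (hK.differentiable (by simp)).differentiableAt.mdifferentiableAt
  have h3 := mfderiv_comp s h2 h1
  rw [mfderiv_extChartAt_self, mfderiv_eq_fderiv] at h3
  exact congrArg (fun A : E →L[ℂ] F => A v) h3

theorem eventually_isIncidenceLift (s : incidence V) : ∀ᶠ t in 𝓝 s,
    IsIncidenceLift t
      (incidencePoint (incidenceCoord s) (extChartAt 𝓘(ℂ, IncidenceModel V) s t))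
      (incidenceForm (incidenceCoord s) (extChartAt 𝓘(ℂ, IncidenceModel V) s t)) := by
  filter_upwards [(chartAt (IncidenceModel V) s).open_source.mem_nhds
    (mem_chart_source (IncidenceModel V) s)] with t ht
  exact isIncidenceLift_chart ht

theorem contMDiff_incidence_fst : ContMDiff 𝓘(ℂ, IncidenceModel V) 𝓘(ℂ, ProjModel V) ω
    (fun s : incidence V => s.1.1) := fun s =>
  contMDiffAt_proj_of_lift
    (contMDiffAt_extChartAt_comp (contDiff_incidencePoint (incidenceCoord s)) s)
    ((eventually_isIncidenceLift s).mono fun _ ht => ht.fst)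

theorem contMDiff_incidence_snd :
    ContMDiff 𝓘(ℂ, IncidenceModel V) 𝓘(ℂ, ProjModel (V →L[ℂ] ℂ)) ω
      (fun s : incidence V => s.1.2) := fun s =>
  contMDiffAt_proj_of_lift
    (contMDiffAt_extChartAt_comp (contDiff_incidenceForm (incidenceCoord s)) s)
    ((eventually_isIncidenceLift s).mono fun _ ht => ht.snd)

theorem mfderiv_incidence_fst (s : incidence V) (v : IncidenceModel V) :
    (mfderiv 𝓘(ℂ, IncidenceModel V) 𝓘(ℂ, ProjModel V) (fun s : incidence V => s.1.1) s :
      IncidenceModel V →L[ℂ] ProjModel V) v =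
      projDeriv s.1.1 (incidencePoint (incidenceCoord s) (extChartAt 𝓘(ℂ, IncidenceModel V) s s))
        ((incidenceCoord s).symm (0, v.1)) := by
  refine (mfderiv_proj_of_lift ((contMDiff_incidence_fst s).mdifferentiableAt (by simp))
    ((contMDiffAt_extChartAt_comp (contDiff_incidencePoint (incidenceCoord s)) s).mdifferentiableAt
      (by simp)) ((eventually_isIncidenceLift s).mono fun _ ht => ht.fst) v).trans ?_
  refine congrArg (projDeriv s.1.1 _) ?_
  rw [← fderiv_incidencePoint]
  exact mfderiv_comp_extChartAt (contDiff_incidencePoint (incidenceCoord s)) s v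

theorem mfderiv_incidence_snd (s : incidence V) (v : IncidenceModel V) :
    (mfderiv 𝓘(ℂ, IncidenceModel V) 𝓘(ℂ, ProjModel (V →L[ℂ] ℂ))
      (fun s : incidence V => s.1.2) s : IncidenceModel V →L[ℂ] ProjModel (V →L[ℂ] ℂ)) v =
      projDeriv s.1.2 (incidenceForm (incidenceCoord s) (extChartAt 𝓘(ℂ, IncidenceModel V) s s))
        (fderiv ℂ (incidenceForm (incidenceCoord s)) (extChartAt 𝓘(ℂ, IncidenceModel V) s s) v) := by
  refine (mfderiv_proj_of_lift ((contMDiff_incidence_snd s).mdifferentiableAt (by simp))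
    ((contMDiffAt_extChartAt_comp (contDiff_incidenceForm (incidenceCoord s)) s).mdifferentiableAt
      (by simp)) ((eventually_isIncidenceLift s).mono fun _ ht => ht.snd) v).trans ?_
  refine congrArg (projDeriv s.1.2 _) ?_
  exact mfderiv_comp_extChartAt (contDiff_incidenceForm (incidenceCoord s)) s v

theorem contMDiffAt_incidence_of_lift {EM HM M : Type*} [NormedAddCommGroup EM]
    [NormedSpace ℂ EM] [TopologicalSpace HM] {IM : ModelWithCorners ℂ EM HM} [TopologicalSpace M]
    [ChartedSpace HM M] {f : M → incidence V} {G : M → V} {Ξ : M → V →L[ℂ] ℂ} {m : M}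
    (hG : ContMDiffAt IM 𝓘(ℂ, V) ω G m) (hΞ : ContMDiffAt IM 𝓘(ℂ, V →L[ℂ] ℂ) ω Ξ m)
    (h : ∀ᶠ y in 𝓝 m, IsIncidenceLift (f y) (G y) (Ξ y)) :
    ContMDiffAt IM 𝓘(ℂ, IncidenceModel V) ω f m := by
  have h1 : ContMDiffAt IM 𝓘(ℂ, ProjModel V) ω (fun y => (f y).1.1) m :=
    contMDiffAt_proj_of_lift hG (h.mono fun y hy => hy.fst)
  have h2 : ContMDiffAt IM 𝓘(ℂ, ProjModel (V →L[ℂ] ℂ)) ω (fun y => (f y).1.2) m :=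
    contMDiffAt_proj_of_lift hΞ (h.mono fun y hy => hy.snd)
  have hs : f m ∈ (incidenceChart (incidenceCoord (f m))).source :=
    mem_chart_source (IncidenceModel V) (f m)
  refine contMDiffAt_iff_target.2 ⟨?_, ?_⟩
  · exact Topology.IsInducing.subtypeVal.continuousAt_iff.2 (h1.continuousAt.prodMk h2.continuousAt)
  · have h3 := ContMDiffAt.comp m (contMDiffAt_affineChart (incidenceCoord (f m)) hs.1) h1
    have h4 := ContMDiffAt.comp m
      (contMDiffAt_affineChart (dualCoord (incidenceCoord (f m))) hs.2) h2
    -- The last dual affine coordinate is dropped: the incidence relation determines it.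
    exact h3.prodMk_space (contDiff_fst.contMDiff.contMDiffAt.comp m h4)

theorem projDeriv_eq_zero {p : ℙ ℂ V} {x : V} (hx : ∃ h : x ≠ 0, p = Projectivization.mk ℂ x h)
    {v : V} (hv : projDeriv p x v = 0) : ∃ c : ℂ, v = c • x := by
  obtain ⟨h, rfl⟩ := hx
  have := projDerivSection_projDeriv (preferredCoord_ne_zero h) v
  rw [hv, map_zero] at this
  exact ⟨_, sub_eq_zero.1 this.symm⟩

/-- In coordinates `(x', x₁, ξ')` with `x₀ = ξ₁ = 1`, the first projection has kernel `dx' = 0`,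
`dx₁ = 0`, and the second has kernel `dξ' = 0`, `ξ' dx' + dx₁ = 0`. Their sum is `ξ' dx' + dx₁ = 0`,
which is `⟨ξ, dx⟩ = 0`. -/
theorem mem_incidenceContact_iff (s : incidence V) (v : IncidenceModel V) :
    v ∈ (incidenceContact s : Submodule ℂ (IncidenceModel V)) ↔
      incidenceForm (incidenceCoord s) (extChartAt 𝓘(ℂ, IncidenceModel V) s s)
        ((incidenceCoord s).symm (0, v.1)) = 0 := by
  set e := incidenceCoord s
  set y := extChartAt 𝓘(ℂ, IncidenceModel V) s s
  have hl := (eventually_isIncidenceLift s).self_of_nhds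
  have hp : ∀ u : IncidenceModel V,
      incidenceForm e y (e.symm (0, u.1)) = y.2 u.1.1 + u.1.2 := fun u => by
    rw [incidenceForm_apply]; simp
  rw [hp]
  have hmem : v ∈ (incidenceContact s : Submodule ℂ (IncidenceModel V)) ↔
      ∃ a b : IncidenceModel V, a + b = v ∧ projDeriv s.1.1 (incidencePoint e y) (e.symm (0, a.1)) = 0 ∧
        projDeriv s.1.2 (incidenceForm e y) (fderiv ℂ (incidenceForm e) y b) = 0 := by
    refine (Submodule.mem_sup (R := ℂ) (M := IncidenceModel V)).trans ?_
    constructor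
    · rintro ⟨a, ha, b, hb, rfl⟩
      exact ⟨a, b, rfl, (mfderiv_incidence_fst s a).symm.trans ha,
        (mfderiv_incidence_snd s b).symm.trans hb⟩
    · rintro ⟨a, b, rfl, ha, hb⟩
      exact ⟨a, (mfderiv_incidence_fst s a).trans ha, b, (mfderiv_incidence_snd s b).trans hb, rfl⟩
  rw [hmem]
  constructor
  · rintro ⟨a, b, rfl, ha, hb⟩
    obtain ⟨c, hc⟩ := projDeriv_eq_zero hl.fst ha
    obtain ⟨d, hd⟩ := projDeriv_eq_zero hl.snd hb
    have hc' := congrArg e hc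
    rw [map_smul, incidencePoint, e.apply_symm_apply, e.apply_symm_apply] at hc'
    -- The variation of the lift is a multiple of the lift, but its normalized coordinate is
    -- constantly `1`, so the multiple is `0`. The same argument gives `d = 0` below.
    have hc0 : c = 0 := by simpa using (congrArg Prod.fst hc').symm
    have ha1 : a.1 = 0 := by simpa [hc0] using congrArg Prod.snd hc'
    have hd' := congrArg (dualCoord e) hd
    rw [map_smul, incidenceForm, fderiv_incidenceForm, ContinuousLinearEquiv.apply_symm_apply,
      ContinuousLinearEquiv.apply_symm_apply] at hd'
    have hd1 : (0 : ℂ) = d * 1 := congrArg Prod.fst hd'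
    have hd0 : d = 0 := by simpa using hd1.symm
    have hb1 : b.2 = d • y.2 := congrArg (fun p => p.2.1) hd'
    have hb2 : -(y.2 b.1.1 + b.2 y.1.1 + b.1.2) = d * -(y.2 y.1.1 + y.1.2) :=
      congrArg (fun p => p.2.2) hd'
    have hb3 : b.2 y.1.1 = d * y.2 y.1.1 := congrArg (fun A : MidCoord V →L[ℂ] ℂ => A y.1.1) hb1
    rw [hb3, hd0, zero_mul, zero_mul, add_zero] at hb2
    simp only [Prod.fst_add, ha1, zero_add]
    exact neg_eq_zero.1 hb2
  · intro h
    -- The splitting moves only `[ξ]` in the first summand; the second keeps `ξ'` fixed, and the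
    -- hypothesis says that it then fixes all of `ξ`.
    refine ⟨(0, v.2), (v.1, 0), by simp, ?_, ?_⟩
    · change projDeriv s.1.1 _ (e.symm 0) = 0
      rw [map_zero, map_zero]
    · rw [fderiv_incidenceForm]
      have h0 : -(y.2 v.1.1 + (0 : MidCoord V →L[ℂ] ℂ) y.1.1 + v.1.2) = 0 := by
        rw [zero_apply, add_zero, h, neg_zero]
      rw [h0]
      change projDeriv s.1.2 _ ((dualCoord e).symm 0) = 0
      rw [map_zero, map_zero]

end IncidenceMaps

/-! ### The contact isomorphism with the incidence hypersurface. -/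

section ProjCotangentIncidence

variable {V : Type*} [NormedAddCommGroup V] [NormedSpace ℂ V] [FiniteDimensional ℂ V]

/-- The map `([x], p) ↦ ([x], [ξ])`, where `ξ` is the pull-back of `p` to `x`. -/
def toIncidence (z : ProjT V) : incidence V :=
  ⟨(z.1.1, Projectivization.mk ℂ (coLift z z.1.1.rep) (IsCoLift.rep z).dual_ne_zero), by
    conv in z.1.1 => rw [(IsCoLift.rep z).mk_eq]
    rw [mem_incidence_mk]
    exact coLift_self z _⟩

theorem IsCoLift.toIncidence {z : ProjT V} {x : V} {ξ : V →L[ℂ] ℂ} (h : IsCoLift z x ξ) :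
    IsIncidenceLift (toIncidence z) x ξ where
  fst := ⟨h.ne_zero, h.mk_eq⟩
  snd := by
    obtain ⟨c, -, hξ⟩ := (IsCoLift.rep z).exists_unit h
    exact ⟨h.dual_ne_zero, (Projectivization.mk_eq_mk_iff ℂ _ _ _ _).2
      ⟨c, by simp [hξ, Units.smul_def]⟩⟩

omit [FiniteDimensional ℂ V] in
theorem IsIncidenceLift.unique {s t : incidence V} {x : V} {ξ : V →L[ℂ] ℂ}
    (hs : IsIncidenceLift s x ξ) (ht : IsIncidenceLift t x ξ) : s = t := by
  obtain ⟨⟨_, h1⟩, ⟨_, h2⟩⟩ := hs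
  obtain ⟨⟨_, h3⟩, ⟨_, h4⟩⟩ := ht
  exact Subtype.ext (Prod.ext (h1.trans h3.symm) (h2.trans h4.symm))

omit [FiniteDimensional ℂ V] in
theorem IsIncidenceLift.smul {s : incidence V} {x : V} {ξ : V →L[ℂ] ℂ}
    (hs : IsIncidenceLift s x ξ) (a b : ℂˣ) :
    IsIncidenceLift s ((a : ℂ) • x) ((b : ℂ) • ξ) := by
  obtain ⟨⟨hx, h1⟩, ⟨hξ, h2⟩⟩ := hs
  exact ⟨⟨smul_ne_zero a.ne_zero hx, h1.trans ((Projectivization.mk_eq_mk_iff ℂ _ _ _ _).2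
      ⟨a⁻¹, by simp [Units.smul_def]⟩)⟩, ⟨smul_ne_zero b.ne_zero hξ,
      h2.trans ((Projectivization.mk_eq_mk_iff ℂ _ _ _ _).2 ⟨b⁻¹, by simp [Units.smul_def]⟩)⟩⟩

omit [FiniteDimensional ℂ V] in
theorem IsIncidenceLift.exists_units {s : incidence V} {x x' : V} {ξ ξ' : V →L[ℂ] ℂ}
    (h : IsIncidenceLift s x ξ) (h' : IsIncidenceLift s x' ξ') :
    ∃ a b : ℂˣ, x' = (a : ℂ) • x ∧ ξ' = (b : ℂ) • ξ := by
  obtain ⟨⟨hx, h1⟩, ⟨hξ, h2⟩⟩ := h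
  obtain ⟨⟨hx', h3⟩, ⟨hξ', h4⟩⟩ := h'
  obtain ⟨a, ha⟩ := (Projectivization.mk_eq_mk_iff ℂ _ _ hx' hx).1 (h3.symm.trans h1)
  obtain ⟨b, hb⟩ := (Projectivization.mk_eq_mk_iff ℂ _ _ hξ' hξ).1 (h4.symm.trans h2)
  exact ⟨a, b, ha.symm, hb.symm⟩

omit [FiniteDimensional ℂ V] in
theorem isIncidenceLift_rep (s : incidence V) : IsIncidenceLift s s.1.1.rep s.1.2.rep :=
  ⟨⟨s.1.1.rep_nonzero, s.1.1.mk_rep.symm⟩, ⟨s.1.2.rep_nonzero, s.1.2.mk_rep.symm⟩⟩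

theorem toIncidence_smul (c : ℂˣ) (z : ProjT V) : toIncidence (c • z) = toIncidence z := by
  have h := (IsCoLift.rep z).toIncidence.smul 1 c
  rw [Units.val_one, one_smul] at h
  exact ((IsCoLift.rep z).smul_left c).toIncidence.unique h

theorem contMDiff_toIncidence :
    ContMDiff (cotangentModel (ProjModel V)) 𝓘(ℂ, IncidenceModel V) ω
      (toIncidence (V := V)) := by
  intro z
  obtain ⟨G, Ξ, hG, hΞ, hl⟩ := exists_isCoLift z
  exact contMDiffAt_incidence_of_lift hG hΞ (hl.mono fun _ h => h.toIncidence)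

/-- The covector `([x], [p])` corresponding to `([x], [ξ])`, where `p` pulls back to `ξ` at `x`. -/
def ofIncidence (s : incidence V) : ProjCotangent (ProjModel V) (ℙ ℂ V) :=
  projCotangentMk (ofLift s.1.1.rep s.1.2.rep s.1.1.rep_nonzero s.1.2.rep_nonzero s.2)

theorem IsIncidenceLift.ofIncidence_eq {s : incidence V} {x : V} {ξ : V →L[ℂ] ℂ}
    (h : IsIncidenceLift s x ξ) {z : ProjT V} (hz : IsCoLift z x ξ) :
    ofIncidence s = projCotangentMk z := by
  obtain ⟨a, b, hx, hξ⟩ := h.exists_units (isIncidenceLift_rep s)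
  have h1 := isCoLift_ofLift s.1.1.rep_nonzero s.1.2.rep_nonzero s.2
  -- The representatives are `a x` and `b ξ`. Passing to `a x` turns `ξ` into `a⁻¹ ξ`, and the
  -- factor `b * a` brings it to `b ξ`.
  have h2 := (hz.smul a).smul_left (b * a)
  rw [Units.val_mul, smul_smul, mul_inv_cancel_right₀ a.ne_zero, ← hx, ← hξ] at h2
  exact projCotangentMk_eq_iff.2 ⟨_, h2.unique h1⟩

theorem contMDiff_ofIncidence :
    ContMDiff 𝓘(ℂ, IncidenceModel V) (projCotangentModel (ProjModel V)) ω
      (ofIncidence (V := V)) := by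
  intro s
  let G := fun t : incidence V =>
    incidencePoint (incidenceCoord s) (extChartAt 𝓘(ℂ, IncidenceModel V) s t)
  let Ξ := fun t : incidence V =>
    incidenceForm (incidenceCoord s) (extChartAt 𝓘(ℂ, IncidenceModel V) s t)
  -- The local lift is valid only on the chart domain; elsewhere an arbitrary covector is chosen, so
  -- that `F` is defined everywhere.
  have hF : ∀ t : incidence V, ∃ w : ProjT V, IsIncidenceLift t (G t) (Ξ t) →
      IsCoLift w (G t) (Ξ t) := fun t => by
    by_cases ht : IsIncidenceLift t (G t) (Ξ t)
    · exact ⟨_, fun _ => isCoLift_ofLift ht.fst.choose ht.snd.choose ht.apply_eq_zero⟩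
    · exact ⟨ofLift t.1.1.rep t.1.2.rep t.1.1.rep_nonzero t.1.2.rep_nonzero t.2,
        fun h => (ht h).elim⟩
  choose F hF using hF
  have hl : ∀ᶠ t in 𝓝 s, IsIncidenceLift t (G t) (Ξ t) := eventually_isIncidenceLift s
  have h1 : ContMDiffAt 𝓘(ℂ, IncidenceModel V) (cotangentModel (ProjModel V)) ω F s :=
    contMDiffAt_of_isCoLift
      (contMDiffAt_extChartAt_comp (contDiff_incidencePoint (incidenceCoord s)) s)
      (contMDiffAt_extChartAt_comp (contDiff_incidenceForm (incidenceCoord s)) s)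
      (hl.mono fun t ht => hF t ht)
  refine (ContMDiffAt.comp s (contMDiff_projCotangentMk (F s)) h1).congr_of_eventuallyEq ?_
  filter_upwards [hl] with t ht
  exact ht.ofIncidence_eq (hF t ht)

theorem toIncidence_lift_mk (z : ProjT V) :
    toIncidence (ProjCotangent.lift (projCotangentMk z)) = toIncidence z := by
  obtain ⟨c, hc⟩ := projCotangentMk_eq_iff.1 (projCotangentMk_lift (projCotangentMk z))
  rw [← hc, toIncidence_smul]

/-- The isomorphism between the projectivized cotangent bundle of projective space and the
incidence hypersurface. -/
def incidenceDiffeomorph (V : Type*) [NormedAddCommGroup V] [NormedSpace ℂ V]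
    [FiniteDimensional ℂ V] :
    Diffeomorph (projCotangentModel (ProjModel V)) 𝓘(ℂ, IncidenceModel V)
      (ProjCotangent (ProjModel V) (ℙ ℂ V)) (incidence V) ω where
  toFun z := toIncidence (ProjCotangent.lift z)
  invFun := ofIncidence
  left_inv z := by
    rw [(IsCoLift.rep _).toIncidence.ofIncidence_eq (IsCoLift.rep _), projCotangentMk_lift]
  right_inv s := (toIncidence_lift_mk _).trans
    ((isCoLift_ofLift _ _ _).toIncidence.unique (isIncidenceLift_rep s))
  contMDiff_toFun := contMDiff_of_comp_projCotangentMk contMDiff_toIncidence toIncidence_lift_mk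
  contMDiff_invFun := contMDiff_ofIncidence

theorem incidenceDiffeomorph_mk (z : ProjT V) :
    incidenceDiffeomorph V (projCotangentMk z) = toIncidence z := toIncidence_lift_mk z

/-- The contact hyperplane of the incidence hypersurface at `([x], [ξ])` consists of the tangent
vectors whose image in the tangent space at `[x]` is annihilated by the covector with lift `ξ`. -/
theorem mem_incidenceContact_toIncidence {z : ProjT V} {s : incidence V} (hs : toIncidence z = s)
    (v : IncidenceModel V) :
    v ∈ (incidenceContact s : Submodule ℂ (IncidenceModel V)) ↔
      covectorForm z ((mfderiv 𝓘(ℂ, IncidenceModel V) 𝓘(ℂ, ProjModel V)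
        (fun s : incidence V => s.1.1) s : IncidenceModel V →L[ℂ] ProjModel V) v) = 0 := by
  have hl := (eventually_isIncidenceLift s).self_of_nhds
  -- The normalized chart lift and the lift of `z` differ by nonzero scalars, which do not affect
  -- the vanishing of the pairing.
  obtain ⟨a, b, hx, hξ⟩ := (hs ▸ (IsCoLift.rep z).toIncidence).exists_units hl
  have hz : s.1.1 = z.1.1 := by rw [← hs]; rfl
  rw [mem_incidenceContact_iff, mfderiv_incidence_fst, hz, ← coLift_apply, hx, hξ,
    coLift_smul_right]
  simp

/-- The isomorphism commutes with the projections to `ℙ V`, and both hyperplanes consist of the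
vectors whose image in `ℙ V` is annihilated by the same covector. -/
theorem isContactIso_incidenceDiffeomorph :
    IsContactIso projCotangentContact incidenceContact (incidenceDiffeomorph V) := by
  refine isContactIso_of_mem_iff fun z v => ?_
  have h1 := mfderiv_comp z
    ((contMDiff_incidence_fst (incidenceDiffeomorph V z)).mdifferentiableAt (by simp))
    (((incidenceDiffeomorph V).contMDiff z).mdifferentiableAt (by simp))
  refine (mem_projCotangentContact_iff (projCotangentMk_lift z)).trans ?_
  refine Iff.trans ?_ (mem_incidenceContact_toIncidence (z := ProjCotangent.lift z) rfl _).symm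
  exact Eq.congr_left (congrArg (fun A : ProjModel V × ProjModel (ProjModel V →L[ℂ] ℂ) →L[ℂ]
    ProjModel V => covectorForm (ProjCotangent.lift z) (A v)) h1)

theorem IsCoLift.exists_pullsBackTo {z : ProjT V} {x : Punctured V} {ξ : V →L[ℂ] ℂ}
    (h : IsCoLift z x ξ) :
    ∃ (p : TangentSpace 𝓘(ℂ, ProjModel V) (projMap x) →L[ℂ] ℂ) (hp : p ≠ 0),
      PullsBackTo x p ξ ∧ z = PuncturedCotangent.mk (projMap x) p hp := by
  obtain ⟨⟨b, p⟩, hp⟩ := z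
  obtain rfl : b = projMap x := h.mk_eq
  exact ⟨p, hp, pullsBackTo_of_isCoLift x hp h, rfl⟩

end ProjCotangentIncidence

/-! ### Biduality and composition of the isomorphisms. -/

theorem IsContactIso.symm_trans {E H : Type*} [NormedAddCommGroup E] [NormedSpace ℂ E]
    [TopologicalSpace H] {I : ModelWithCorners ℂ E H} {M : Type*} [TopologicalSpace M]
    [ChartedSpace H M] {E' H' : Type*} [NormedAddCommGroup E'] [NormedSpace ℂ E']
    [TopologicalSpace H'] {J : ModelWithCorners ℂ E' H'} {N : Type*} [TopologicalSpace N]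
    [ChartedSpace H' N] {E'' H'' : Type*} [NormedAddCommGroup E''] [NormedSpace ℂ E'']
    [TopologicalSpace H''] {K : ModelWithCorners ℂ E'' H''} {P : Type*} [TopologicalSpace P]
    [ChartedSpace H'' P] {A : ∀ z : M, Submodule ℂ (TangentSpace I z)}
    {B : ∀ z : N, Submodule ℂ (TangentSpace J z)} {C : ∀ z : P, Submodule ℂ (TangentSpace K z)}
    {Ψ : Diffeomorph I J M N ω} {Φ : Diffeomorph I K M P ω}
    (hΨ : IsContactIso A B Ψ) (hΦ : IsContactIso A C Φ) :
    IsContactIso B C (Ψ.symm.trans Φ) := by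
  intro w
  obtain ⟨z, rfl⟩ := Ψ.surjective w
  have h1 := mfderiv_comp z (((Ψ.symm.trans Φ).contMDiff (Ψ z)).mdifferentiableAt (by simp))
    ((Ψ.contMDiff z).mdifferentiableAt (by simp))
  have h2 : (Ψ.symm.trans Φ) ∘ Ψ = Φ := funext fun y => by simp
  have hC : ∀ a b : P, a = b → (C a : Submodule ℂ E'') = C b := by
    rintro a _ rfl; rfl
  have h3 := hC _ _ (congrFun h2 z)
  change (B (Ψ z)).map (mfderiv J K (Ψ.symm.trans Φ) (Ψ z)).toLinearMap = _
  -- Writing `B` as the image of `A` under `dΨ` avoids the differential of the inverse: the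
  -- composite of differentials is that of `Φ`.
  rw [← hΨ z, ← Submodule.map_comp]
  refine Eq.trans ?_ h3.symm
  refine Eq.trans ?_ (hΦ z)
  have h4 : mfderiv I K ((Ψ.symm.trans Φ) ∘ Ψ) z = mfderiv I K Φ z := by rw [h2]
  exact congrArg (fun L : E →L[ℂ] E'' => (A z : Submodule ℂ E).map L.toLinearMap)
    (h1.symm.trans h4)

/-- Evaluation as an isomorphism of a finite-dimensional space with its bidual, with the opposite
sign. -/
def negBidual (V : Type*) [NormedAddCommGroup V] [NormedSpace ℂ V] [FiniteDimensional ℂ V] :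
    ((V →L[ℂ] ℂ) →L[ℂ] ℂ) ≃L[ℂ] V :=
  (LinearEquiv.ofBijective (-(ContinuousLinearMap.apply ℂ ℂ : V →L[ℂ] (V →L[ℂ] ℂ) →L[ℂ] ℂ)).toLinearMap
    (by
      -- A space and its dual have equal dimension, so the injective evaluation map into the bidual
      -- is bijective.
      have hdim : ∀ W : Type _, ∀ [NormedAddCommGroup W] [NormedSpace ℂ W] [FiniteDimensional ℂ W],
          finrank ℂ (W →L[ℂ] ℂ) = finrank ℂ W := fun W _ _ _ =>
        (LinearMap.toContinuousLinearMap (𝕜 := ℂ) (E := W) (F' := ℂ)).finrank_eq.symm.trans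
          (Subspace.dual_finrank_eq)
      have hinj : Function.Injective
          (-(ContinuousLinearMap.apply ℂ ℂ : V →L[ℂ] (V →L[ℂ] ℂ) →L[ℂ] ℂ)).toLinearMap := by
        rw [injective_iff_map_eq_zero]
        intro x hx
        by_contra h
        obtain ⟨f, hf⟩ := SeparatingDual.exists_eq_one (R := ℂ) h
        have := congrArg (fun A : (V →L[ℂ] ℂ) →L[ℂ] ℂ => A f) hx
        simp [hf] at this
      exact ⟨hinj, (LinearMap.injective_iff_surjective_of_finrank_eq_finrank
        (by rw [hdim, hdim])).1 hinj⟩)).symm.toContinuousLinearEquiv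

theorem isSkewDual_negBidual (V : Type*) [NormedAddCommGroup V] [NormedSpace ℂ V]
    [FiniteDimensional ℂ V] :
    IsSkewDual (ContinuousLinearEquiv.refl ℂ (V →L[ℂ] ℂ)) (negBidual V) := fun _ _ => rfl

/-- The inverse rule sends the lift `(ξ, x)`, with `x` read in the bidual, to `(-x, ξ)`; the sign
disappears in projective space. This is why the second correspondence is stated with `x` and the
symplectic one with `-x`. -/
theorem isIncidenceLift_dualMap_negBidual {V : Type*} [NormedAddCommGroup V]
    [NormedSpace ℂ V] [FiniteDimensional ℂ V] {w : ProjT (V →L[ℂ] ℂ)} {x : V} {ξ : V →L[ℂ] ℂ}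
    (h : IsCoLift w ξ (ContinuousLinearMap.apply ℂ ℂ x)) :
    IsIncidenceLift (toIncidence (dualMap (isSkewDual_negBidual V).symm w)) x ξ := by
  have h1 := h.dualMap (isSkewDual_negBidual V).symm
  have hx : negBidual V (ContinuousLinearMap.apply ℂ ℂ x) = -x := by
    rw [← (negBidual V).symm.injective.eq_iff, ContinuousLinearEquiv.symm_apply_apply]
    refine ContinuousLinearMap.ext fun ζ => ?_
    rw [isSkewDual_negBidual V]
    simp
  rw [hx] at h1
  have h2 := h1.toIncidence.smul (-1) 1
  simp only [Units.val_neg, Units.val_one, neg_smul, one_smul, neg_neg] at h2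
  exact h2

theorem incidenceDiffeomorph_symm_trans_symm {V : Type*} [NormedAddCommGroup V]
    [NormedSpace ℂ V] [FiniteDimensional ℂ V] {E' : Type*} [NormedAddCommGroup E']
    [NormedSpace ℂ E'] [FiniteDimensional ℂ E'] {Y : Type*} [TopologicalSpace Y]
    [ChartedSpace E' Y] [IsManifold 𝓘(ℂ, E') ω Y]
    {χ : Diffeomorph (cotangentModel (ProjModel V)) (cotangentModel E')
      (ProjT V) (PuncturedCotangent E' Y) ω}
    (hχ : ∀ (c : ℂˣ) z, χ (c • z) = c • χ z) {z : ProjT V} {w : PuncturedCotangent E' Y}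
    (h : χ z = w) :
    ((incidenceDiffeomorph V).symm.trans (projCotangentDiffeomorph χ hχ)).symm
      (projCotangentMk w) = toIncidence z := by
  have h3 : projCotangentMk w = projCotangentDiffeomorph χ hχ (projCotangentMk z) := by
    rw [projCotangentDiffeomorph_mk, h]
  refine Eq.trans (congrArg (incidenceDiffeomorph V) ?_) (incidenceDiffeomorph_mk z)
  change (projCotangentDiffeomorph χ hχ).symm (projCotangentMk w) = projCotangentMk z
  rw [h3, Diffeomorph.symm_apply_apply]

end

theorem mainTheorem11 (n : ℕ) (V : Type*) [NormedAddCommGroup V] [NormedSpace ℂ V]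
    [FiniteDimensional ℂ V] (hV : Module.finrank ℂ V = n + 1) :
    (∃ χ : Diffeomorph (cotangentModel (ProjModel V)) (cotangentModel (ProjModel (V →L[ℂ] ℂ)))
        (PuncturedCotangent (ProjModel V) (ℙ ℂ V))
        (PuncturedCotangent (ProjModel (V →L[ℂ] ℂ)) (ℙ ℂ (V →L[ℂ] ℂ))) ω,
      IsHomogeneousSymplectic χ ∧
      ∀ (x : Punctured V) (ξ : Punctured (V →L[ℂ] ℂ))
        (p : TangentSpace 𝓘(ℂ, ProjModel V) (projMap x) →L[ℂ] ℂ) (hp : p ≠ 0),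
        PullsBackTo x p ξ →
        ∃ (q : TangentSpace 𝓘(ℂ, ProjModel (V →L[ℂ] ℂ)) (projMap ξ) →L[ℂ] ℂ) (hq : q ≠ 0),
          PullsBackTo ξ q (-ContinuousLinearMap.apply ℂ ℂ (x : V)) ∧
          χ (PuncturedCotangent.mk (projMap x) p hp) =
            PuncturedCotangent.mk (projMap ξ) q hq) ∧
    (∃ (Ψ₁ : Diffeomorph (projCotangentModel (ProjModel V)) 𝓘(ℂ, IncidenceModel V)
          (ProjCotangent (ProjModel V) (ℙ ℂ V)) (incidence V) ω)
        (Ψ₂ : Diffeomorph 𝓘(ℂ, IncidenceModel V) (projCotangentModel (ProjModel (V →L[ℂ] ℂ)))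
          (incidence V) (ProjCotangent (ProjModel (V →L[ℂ] ℂ)) (ℙ ℂ (V →L[ℂ] ℂ))) ω),
      IsContactIso projCotangentContact incidenceContact Ψ₁ ∧
      IsContactIso incidenceContact projCotangentContact Ψ₂ ∧
      (∀ (x : Punctured V) (ξ : Punctured (V →L[ℂ] ℂ))
        (p : TangentSpace 𝓘(ℂ, ProjModel V) (projMap x) →L[ℂ] ℂ) (hp : p ≠ 0),
        PullsBackTo x p ξ →
        (Ψ₁ ⟨projMap x, Projectivization.mk ℂ p hp⟩).1 = (projMap x, projMap ξ)) ∧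
      (∀ (x : Punctured V) (ξ : Punctured (V →L[ℂ] ℂ))
        (q : TangentSpace 𝓘(ℂ, ProjModel (V →L[ℂ] ℂ)) (projMap ξ) →L[ℂ] ℂ) (hq : q ≠ 0),
        PullsBackTo ξ q (ContinuousLinearMap.apply ℂ ℂ (x : V)) →
        (Ψ₂.symm ⟨projMap ξ, Projectivization.mk ℂ q hq⟩).1 = (projMap x, projMap ξ))) := by

  -- With `D` the identity of `V*` and `D'⁻¹` the negative of evaluation, the general rule `(x, ξ) ↦
  -- (D ξ, D'⁻¹ x)` becomes `(x, ξ) ↦ (ξ, -x)`.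
  have hD := isSkewDual_negBidual V
  have hχ := isHomogeneousSymplectic_dualDiffeomorph hD
  refine ⟨⟨dualDiffeomorph hD, hχ, ?_⟩, incidenceDiffeomorph V,
    (incidenceDiffeomorph V).symm.trans (projCotangentDiffeomorph _ hχ.map_smul),
    isContactIso_incidenceDiffeomorph,
    isContactIso_incidenceDiffeomorph.symm_trans (isContactIso_projCotangentDiffeomorph hχ),
    ?_, ?_⟩
  · intro x ξ p hp hpx
    exact ((isCoLift_mk x hp hpx).dualMap hD).exists_pullsBackTo
  · intro x ξ p hp hpx
    have h1 := (isCoLift_mk x hp hpx).toIncidence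
    refine (congrArg Subtype.val (incidenceDiffeomorph_mk
      (PuncturedCotangent.mk (projMap x) p hp))).trans ?_
    exact Prod.ext h1.fst.choose_spec h1.snd.choose_spec
  · intro x ξ q hq hqx
    have h1 := isIncidenceLift_dualMap_negBidual (isCoLift_mk ξ hq hqx)
    -- The preimage of the given covector under the symplectic isomorphism is its image under the
    -- inverse rule, by `dualMap_dualMap`.
    refine (congrArg Subtype.val (incidenceDiffeomorph_symm_trans_symm hχ.map_smul (dualMap_dualMap
      hD.symm (PuncturedCotangent.mk (projMap ξ) q hq)))).trans ?_
    exact Prod.ext h1.fst.choose_spec h1.snd.choose_spec
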